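/- Let $(X,\Sigma,\mu)$ be a probability space, let $1\le p<\infty$, and let $L^p(X)=L^p(X,\Sigma,\mu;\mathbb C)$. Let $(T(t))_{t\ge 0}$ be a $C_0$-semigroup of bounded linear operators on $L^p(X)$ with generator $(A,D(A))$. Then the following assertions are equivalent. (i) $(T(t))_{t\ge 0}$ is a semigroup of Markov lattice operators, i.e. for every $t\ge 0$ the operator $T(t)$ is positive and satisfies $|T(t)f|=T(t)|f|$ and $\int_X T(t)f\,d\mu=\int_X f\,d\mu$ for all $f\in L^p(X)$, and $T(t)\mathbf 1=\mathbf 1$. (ii) For each $t\ge 0$ there exists a measure algebra homomorphism $\varphi_t^*\colon\Sigma(X)\to\Sigma(X)$ such that $T(t)\mathbf 1_M=\mathbf 1_{\varphi_t^*(M)}$ for all $M\in\Sigma(X)$. Here $\Sigma(X)$ is the measure algebra of measurable sets modulo $\mu$-null sets, and a measure algebra homomorphism is a map $\theta\colon\Sigma(X)\to\Sigma(X)$ that preserves finite unions and intersections and satisfies $\mu(\theta(M))=\mu(M)$ for all $M\in\Sigma(X)$. (iii) $T(t)L^\infty(X)\subseteq L^\infty(X)$ for all $t\ge 0$; the space $D(A)\cap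 L^\infty(X)$ is a subalgebra of $L^\infty(X)$ that is dense in $L^p(X)$, contains $\mathbf 1$ and is invariant under complex conjugation; $A$ is a derivation on it, i.e. $A(fg)=Af\cdot g+f\cdot Ag$ and $A\overline f=\overline{Af}$ for all $f,g\in D(A)\cap L^\infty(X)$; and $A'\mu=0$, i.e. $\int_X Af\,d\mu=0$ for all $f\in D(A)$. -/

import Mathlib

open MeasureTheory Filter Topology
open scoped ENNReal NNReal

namespace Koopman

/-! ### `C₀`-semigroups and their generators -/

/-- A `C₀`-semigroup (strongly continuous one-parameter semigroup of bounded linear operators)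
on a complex normed space. -/
structure C0Semigroup (E : Type*) [NormedAddCommGroup E] [NormedSpace ℂ E] where
  /-- the operator at time `t` -/
  op : ℝ≥0 → E →L[ℂ] E
  op_zero : op 0 = ContinuousLinearMap.id ℂ E
  op_add : ∀ s t : ℝ≥0, op (s + t) = (op s).comp (op t)
  continuous_orbit : ∀ f : E, Continuous fun t : ℝ≥0 => op t f

namespace C0Semigroup

variable {E : Type*} [NormedAddCommGroup E] [NormedSpace ℂ E]

/-- The difference quotient `(T(h) f - f) / h`. -/
noncomputable def quot (T : C0Semigroup E) (f : E) (h : ℝ≥0) : E :=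
  ((h : ℝ) : ℂ)⁻¹ • (T.op h f - f)

theorem quot_add (T : C0Semigroup E) (f g : E) :
    T.quot (f + g) = fun h => T.quot f h + T.quot g h := by
  funext h
  simp only [quot, map_add, ← smul_add]
  congr 1
  abel

theorem quot_smul (T : C0Semigroup E) (c : ℂ) (f : E) :
    T.quot (c • f) = fun h => c • T.quot f h := by
  funext h
  simp only [quot, map_smul, ← smul_sub]
  rw [smul_comm]

/-- The generator `(A, D(A))`: `D(A)` consists of all `f` for which `(T(h) f - f) / h` converges in
norm as `h ↓ 0`, and `A f` is the limit. -/
noncomputable def generator (T : C0Semigroup E) : E →ₗ.[ℂ] E where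
  domain :=
    { carrier := {f | ∃ g : E, Tendsto (T.quot f) (𝓝[>] 0) (𝓝 g)}
      zero_mem' := ⟨0, by
        have : T.quot 0 = fun _ => 0 := by funext h; simp [quot]
        rw [this]
        exact tendsto_const_nhds⟩
      add_mem' := by
        rintro f g ⟨a, ha⟩ ⟨b, hb⟩
        exact ⟨a + b, by rw [quot_add]; exact ha.add hb⟩
      smul_mem' := by
        rintro c f ⟨a, ha⟩
        exact ⟨c • a, by rw [quot_smul]; exact ha.const_smul c⟩ }
  toFun :=
    { toFun := fun f => f.2.choose
      map_add' := by
        intro f g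
        refine tendsto_nhds_unique (f := T.quot ((f : E) + g)) (f + g).2.choose_spec ?_
        rw [quot_add]
        exact f.2.choose_spec.add g.2.choose_spec
      map_smul' := by
        intro c f
        refine tendsto_nhds_unique (f := T.quot (c • (f : E))) (c • f).2.choose_spec ?_
        rw [quot_smul]
        exact f.2.choose_spec.const_smul c }

theorem mem_generator_domain (T : C0Semigroup E) (f : E) :
    f ∈ T.generator.domain ↔ ∃ g : E, Tendsto (T.quot f) (𝓝[>] 0) (𝓝 g) := Iff.rfl

theorem tendsto_generator (T : C0Semigroup E) (f : T.generator.domain) :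
    Tendsto (T.quot f) (𝓝[>] 0) (𝓝 (T.generator f)) := f.2.choose_spec

end C0Semigroup

variable {X : Type*} [MeasurableSpace X]

/-! ### The measure algebra -/

/-- Measurable sets are identified when they agree almost everywhere. -/
def measurableSetSetoid (μ : Measure X) : Setoid {s : Set X // MeasurableSet s} where
  r s t := (s : Set X) =ᵐ[μ] (t : Set X)
  iseqv := ⟨fun _ => EventuallyEq.rfl, fun h => h.symm, fun h h' => h.trans h'⟩

/-- The measure algebra of `(X, μ)`: measurable sets modulo null sets. -/
def MeasureAlgebra (μ : Measure X) : Type _ := Quotient (measurableSetSetoid μ)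

namespace MeasureAlgebra

variable {μ : Measure X}

/-- The class of a measurable set. -/
def mk (μ : Measure X) (s : Set X) (hs : MeasurableSet s) : MeasureAlgebra μ :=
  Quotient.mk (measurableSetSetoid μ) ⟨s, hs⟩

/-- The order is inclusion up to a null set; suprema and infima are represented by unions and
intersections. -/
instance : Lattice (MeasureAlgebra μ) where
  le := Quotient.lift₂ (fun s t => (s : Set X) ≤ᵐ[μ] (t : Set X)) (by
    intro a b a' b' h h'
    exact propext ⟨fun H => (EventuallyEq.symm h).le.trans (H.trans (EventuallyEq.le h')),
      fun H => (EventuallyEq.le h).trans (H.trans (EventuallyEq.symm h').le)⟩)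
  le_refl := by
    rintro ⟨a⟩
    exact EventuallyLE.refl _ _
  le_trans := by
    rintro ⟨a⟩ ⟨b⟩ ⟨c⟩ (h : (a : Set X) ≤ᵐ[μ] (b : Set X)) (h' : (b : Set X) ≤ᵐ[μ] (c : Set X))
    exact h.trans h'
  le_antisymm := by
    rintro ⟨a⟩ ⟨b⟩ (h : (a : Set X) ≤ᵐ[μ] (b : Set X)) (h' : (b : Set X) ≤ᵐ[μ] (a : Set X))
    exact Quotient.sound (s := measurableSetSetoid μ) (h.antisymm h')
  sup := Quotient.map₂ (fun s t => ⟨(s : Set X) ∪ t, s.2.union t.2⟩)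
    (fun _ _ h _ _ h' => ae_eq_set_union h h')
  inf := Quotient.map₂ (fun s t => ⟨(s : Set X) ∩ t, s.2.inter t.2⟩)
    (fun _ _ h _ _ h' => ae_eq_set_inter h h')
  le_sup_left := by
    rintro ⟨a⟩ ⟨b⟩
    exact Eventually.of_forall fun x hx => Or.inl hx
  le_sup_right := by
    rintro ⟨a⟩ ⟨b⟩
    exact Eventually.of_forall fun x hx => Or.inr hx
  sup_le := by
    rintro ⟨a⟩ ⟨b⟩ ⟨c⟩ (h : (a : Set X) ≤ᵐ[μ] (c : Set X)) (h' : (b : Set X) ≤ᵐ[μ] (c : Set X))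
    change ((a : Set X) ∪ b : Set X) ≤ᵐ[μ] (c : Set X)
    filter_upwards [h, h'] with x hx hx' using fun H => H.elim hx hx'
  inf_le_left := by
    rintro ⟨a⟩ ⟨b⟩
    exact Eventually.of_forall fun x hx => hx.1
  inf_le_right := by
    rintro ⟨a⟩ ⟨b⟩
    exact Eventually.of_forall fun x hx => hx.2
  le_inf := by
    rintro ⟨a⟩ ⟨b⟩ ⟨c⟩ (h : (a : Set X) ≤ᵐ[μ] (b : Set X)) (h' : (a : Set X) ≤ᵐ[μ] (c : Set X))
    change (a : Set X) ≤ᵐ[μ] ((b : Set X) ∩ c : Set X)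
    filter_upwards [h, h'] with x hx hx' using fun H => ⟨hx H, hx' H⟩

/-- The measure of an element of the measure algebra. -/
def measure : MeasureAlgebra μ → ℝ≥0∞ :=
  Quotient.lift (fun s => μ (s : Set X)) fun _ _ h => measure_congr h

/-- The indicator function `𝟙_M ∈ L^p` of an element `M` of the measure algebra. -/
noncomputable def indicator [IsFiniteMeasure μ] (p : ℝ≥0∞) : MeasureAlgebra μ → Lp ℂ p μ :=
  Quotient.lift (fun s => indicatorConstLp p s.2 (measure_ne_top μ _) (1 : ℂ)) (by
    intro a b h
    exact MemLp.toLp_congr _ _ (indicator_ae_eq_of_ae_eq_set h))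

end MeasureAlgebra

/-- A measure algebra homomorphism: a map of the measure algebra into itself which respects the
order structure (finite suprema and infima) and the measure. -/
structure MeasureAlgebraHom (μ : Measure X) extends
    LatticeHom (MeasureAlgebra μ) (MeasureAlgebra μ) where
  measure_map : ∀ M : MeasureAlgebra μ, (toFun M).measure = M.measure

/-! ### Markov lattice operators on `L^p` -/

variable {μ : Measure X} {p : ℝ≥0∞}

/-- The modulus `|f| ∈ L^p` of `f ∈ L^p`. -/
noncomputable def modulus (f : Lp ℂ p μ) : Lp ℂ p μ :=
  LipschitzWith.compLp (c := 1) (g := fun z : ℂ => ((‖z‖ : ℝ) : ℂ))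
    (Complex.isometry_ofReal.lipschitz.comp lipschitzWith_one_norm |>.weaken (by simp))
    (by simp) f

theorem coeFn_modulus (f : Lp ℂ p μ) : modulus f =ᵐ[μ] fun x => ((‖f x‖ : ℝ) : ℂ) :=
  LipschitzWith.coeFn_compLp _ _ f

/-- `f ≥ 0` in `L^p`, i.e. `f` is almost everywhere real and nonnegative. -/
def Nonneg (f : Lp ℂ p μ) : Prop := ∀ᵐ x ∂μ, 0 ≤ (f x).re ∧ (f x).im = 0

/-- A positive operator `S` on `L^p` is a Markov lattice operator if `|S f| = S |f|` for all `f`,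
`S 𝟙 = 𝟙`, and `∫ S f dμ = ∫ f dμ` for all `f`. -/
structure IsMarkovLatticeOperator [IsFiniteMeasure μ] [Fact (1 ≤ p)]
    (S : Lp ℂ p μ →L[ℂ] Lp ℂ p μ) : Prop where
  nonneg : ∀ f, Nonneg f → Nonneg (S f)
  modulus_map : ∀ f, modulus (S f) = S (modulus f)
  map_one : S (Lp.const p μ (1 : ℂ)) = Lp.const p μ (1 : ℂ)
  integral_map : ∀ f, ∫ x, S f x ∂μ = ∫ x, f x ∂μ

/-! ### Derivations -/

/-- `L^∞` as a subspace of `L^p`. -/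
def boundedPart (μ : Measure X) (p : ℝ≥0∞) : Submodule ℂ (Lp ℂ p μ) where
  carrier := {f | MemLp f ∞ μ}
  zero_mem' := (MemLp.zero (ε := ℂ)).ae_eq (Lp.coeFn_zero ℂ p μ).symm
  add_mem' := fun {f g} hf hg => (MemLp.add hf hg).ae_eq (Lp.coeFn_add f g).symm
  smul_mem' := fun c f hf => (MemLp.const_smul hf c).ae_eq (Lp.coeFn_smul c f).symm

theorem memLp_mul_bounded (f g : Lp ℂ p μ) (hg : g ∈ boundedPart μ p) :
    MemLp (fun x => f x * g x) p μ :=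
  (MemLp.mul (p := p) (q := ∞) (r := p) hg (Lp.memLp f) :)

/-- The product `f · g ∈ L^p` of `f ∈ L^p` and `g ∈ L^∞`. -/
noncomputable def mulBounded (f g : Lp ℂ p μ) (hg : g ∈ boundedPart μ p) : Lp ℂ p μ :=
  MemLp.toLp (fun x => f x * g x) (memLp_mul_bounded f g hg)

theorem coeFn_mulBounded (f g : Lp ℂ p μ) (hg : g ∈ boundedPart μ p) :
    mulBounded f g hg =ᵐ[μ] fun x => f x * g x :=
  MemLp.coeFn_toLp _

/-- An operator `δ` in `L^p` whose domain consists of bounded functions is a derivation if its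
domain is a conjugation invariant subalgebra of `L^∞` containing `𝟙`, and
`δ (f · g) = δ f · g + f · δ g`, `δ (conj f) = conj (δ f)`. (`star` is complex conjugation.) -/
structure IsDerivation [IsFiniteMeasure μ] (δ : Lp ℂ p μ →ₗ.[ℂ] Lp ℂ p μ) : Prop where
  bounded : δ.domain ≤ boundedPart μ p
  one_mem : Lp.const p μ (1 : ℂ) ∈ δ.domain
  mul_mem : ∀ f g (_ : f ∈ δ.domain) (hg : g ∈ δ.domain),
    mulBounded f g (bounded hg) ∈ δ.domain
  star_mem : ∀ f ∈ δ.domain, star f ∈ δ.domain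
  map_mul : ∀ f g (hf : f ∈ δ.domain) (hg : g ∈ δ.domain),
    δ ⟨mulBounded f g (bounded hg), mul_mem f g hf hg⟩ =
      mulBounded (δ ⟨f, hf⟩) g (bounded hg) + mulBounded (δ ⟨g, hg⟩) f (bounded hf)
  map_star : ∀ f (hf : f ∈ δ.domain), δ ⟨star f, star_mem f hf⟩ = star (δ ⟨f, hf⟩)

/-- For a `C₀`-semigroup with generator `(A, D(A))` on `L^p`: the space `L^∞` is invariant,
`D(A) ∩ L^∞` is a dense algebra in `L^p` on which `A` is a derivation, and `A' μ = 0`, that is,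
the functional `f ↦ ∫ f dμ` vanishes on the range of `A`. -/
structure HasDerivationGenerator [IsFiniteMeasure μ] [Fact (1 ≤ p)]
    (T : C0Semigroup (Lp ℂ p μ)) : Prop where
  invariant : ∀ t, ∀ f ∈ boundedPart μ p, T.op t f ∈ boundedPart μ p
  dense : Dense ((boundedPart μ p ⊓ T.generator.domain : Submodule ℂ (Lp ℂ p μ)) :
    Set (Lp ℂ p μ))
  derivation : IsDerivation (T.generator.domRestrict (boundedPart μ p))
  integral_generator : ∀ f : T.generator.domain, ∫ x, T.generator f x ∂μ = 0

end Koopman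

/-! ### Semigroups: uniqueness of solutions of `u' = A u`, and orbit means. -/

namespace Koopman

namespace C0Semigroup

variable {E : Type*} [NormedAddCommGroup E] [NormedSpace ℂ E]

/-! The three assertions are tied together by multiplicativity on `L^∞`. A Markov lattice operator
`S` sends `𝟙_M` to some `a ≥ 0` with `|2a - 1| = S|2·𝟙_M - 1| = S𝟙 = 𝟙`, so `a` is again an
indicator; linearity and positivity make `M ↦ {a = 1}` a lattice homomorphism, and preservation of
the integral makes it measure preserving. Conversely, an operator mapping indicators to indicators
compatibly with intersections (`MapsIndicators`) respects products and disjointness of supports,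
hence commutes with the modulus on step functions and, by density, everywhere.

From Markov operators to derivations: differentiating `T(t)(fg) = T(t)f · T(t)g` at `t = 0` gives
the Leibniz rule. Orbit means of a bounded function lie in `D(A)` and keep its bound, which gives
density.

From derivations to Markov operators: by the Leibniz rule, sums, products and conjugates of locally
bounded solutions of `u' = A u` are solutions, hence so is `P(|u|²)` for every real polynomial `P`.
Uniqueness (`IsSolution.eq_op`) yields `T(t)P(|u(0)|²) = P(|u(t)|²)`, and approximating the square
root by polynomials yields `T(t)|u(0)| = |u(t)|`. The difficulty is that the product rule in `L^p`
needs `L^∞` bounds that are locally uniform in time, while invariance of `L^∞` bounds each `T(t)f`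
separately. Baire's theorem and the closed graph theorem supply such bounds for orbits started at
`T(a)f` with `a` arbitrarily small, and then `a → 0`. Finally `A𝟙 = 2A𝟙` gives `T(t)𝟙 = 𝟙`, and `A'μ
= 0` makes `∫ T(t)f` constant in `t`. -/

theorem exists_norm_op_le [CompleteSpace E] (T : C0Semigroup E) (b : ℝ≥0) :
    ∃ M : ℝ, ∀ t ≤ b, ‖T.op t‖ ≤ M := by
  obtain ⟨M, hM⟩ := banach_steinhaus (g := fun t : Set.Icc (0 : ℝ≥0) b => T.op t) (by
    intro f
    obtain ⟨C, hC⟩ := (isCompact_Icc (a := (0 : ℝ≥0)) (b := b)).exists_bound_of_continuousOn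
      (T.continuous_orbit f).continuousOn
    exact ⟨C, fun t => hC t t.2⟩)
  exact ⟨M, fun t ht => hM ⟨t, zero_le, ht⟩⟩

/-- Strong continuity becomes joint continuity because the operators are uniformly bounded on
compact time intervals. -/
theorem tendsto_op_apply [CompleteSpace E] (T : C0Semigroup E) {ι : Type*} {l : Filter ι}
    {t : ι → ℝ≥0} {f : ι → E} {t₀ : ℝ≥0} {f₀ : E} (ht : Tendsto t l (𝓝 t₀))
    (hf : Tendsto f l (𝓝 f₀)) :
    Tendsto (fun i => T.op (t i) (f i)) l (𝓝 (T.op t₀ f₀)) := by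
  obtain ⟨M, hM⟩ := T.exists_norm_op_le (t₀ + 1)
  have hb : ∀ᶠ i in l, t i ≤ t₀ + 1 := by
    have : ∀ᶠ s in 𝓝 t₀, s ≤ t₀ + 1 := Iic_mem_nhds (by simp)
    exact ht.eventually this
  have h1 : Tendsto (fun i => T.op (t i) (f i - f₀)) l (𝓝 0) := by
    have h0 : Tendsto (fun i => M * ‖f i - f₀‖) l (𝓝 0) := by
      simpa using (tendsto_iff_norm_sub_tendsto_zero.1 hf).const_mul M
    refine squeeze_zero_norm' ?_ h0
    filter_upwards [hb] with i hi
    exact ((T.op (t i)).le_opNorm _).trans (by gcongr; exact hM _ hi)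
  have h2 : Tendsto (fun i => T.op (t i) f₀) l (𝓝 (T.op t₀ f₀)) :=
    ((T.continuous_orbit f₀).tendsto t₀).comp ht
  simpa using h1.add h2

theorem op_op (T : C0Semigroup E) (s t : ℝ≥0) (f : E) : T.op s (T.op t f) = T.op (s + t) f := by
  rw [T.op_add]; rfl

theorem quot_op (T : C0Semigroup E) (t : ℝ≥0) (f : E) (h : ℝ≥0) :
    T.quot (T.op t f) h = T.op t (T.quot f h) := by
  simp only [quot, map_smul, map_sub, op_op, add_comm h t]

theorem tendsto_quot_op (T : C0Semigroup E) (t : ℝ≥0) {f g : E}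
    (h : Tendsto (T.quot f) (𝓝[>] 0) (𝓝 g)) :
    Tendsto (T.quot (T.op t f)) (𝓝[>] 0) (𝓝 (T.op t g)) := by
  rw [funext (T.quot_op t f)]
  exact ((T.op t).continuous.tendsto g).comp h

theorem generator_eq (T : C0Semigroup E) {f g : E} (hf : f ∈ T.generator.domain)
    (h : Tendsto (T.quot f) (𝓝[>] 0) (𝓝 g)) : T.generator ⟨f, hf⟩ = g :=
  tendsto_nhds_unique (T.tendsto_generator ⟨f, hf⟩) h

end C0Semigroup

/-- The forward difference quotient of a curve at time `s`. -/
noncomputable def forwardQuot {E : Type*} [NormedAddCommGroup E] [NormedSpace ℂ E]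
    (u : ℝ≥0 → E) (s h : ℝ≥0) : E :=
  ((h : ℝ) : ℂ)⁻¹ • (u (s + h) - u s)

/-- A continuous curve which is right differentiable with `u' = A u`. -/
structure IsSolution {E : Type*} [NormedAddCommGroup E] [NormedSpace ℂ E] (T : C0Semigroup E)
    (u : ℝ≥0 → E) : Prop where
  continuous : Continuous u
  tendsto_quot : ∀ s, ∃ g, Tendsto (T.quot (u s)) (𝓝[>] 0) (𝓝 g) ∧
    Tendsto (forwardQuot u s) (𝓝[>] 0) (𝓝 g)

namespace C0Semigroup

variable {E : Type*} [NormedAddCommGroup E] [NormedSpace ℂ E]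

theorem isSolution_orbit (T : C0Semigroup E) {f : E} (hf : f ∈ T.generator.domain) :
    IsSolution T fun s => T.op s f where
  continuous := T.continuous_orbit f
  tendsto_quot s := by
    obtain ⟨g, hg⟩ := hf
    refine ⟨_, T.tendsto_quot_op s hg, ?_⟩
    convert T.tendsto_quot_op s hg using 1
    funext h
    rw [quot, forwardQuot, op_op, add_comm]

end C0Semigroup

variable {E : Type*} [NormedAddCommGroup E] [NormedSpace ℂ E]

theorem tendsto_toNNReal_sub_nhdsGT (x : ℝ) :
    Tendsto (fun y : ℝ => (y - x).toNNReal) (𝓝[>] x) (𝓝[>] 0) := by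
  refine tendsto_nhdsWithin_iff.2 ⟨?_, ?_⟩
  · have : Continuous fun y : ℝ => (y - x).toNNReal := by fun_prop
    simpa using (this.tendsto x).mono_left nhdsWithin_le_nhds
  · filter_upwards [self_mem_nhdsWithin] with y hy
    simpa using hy

/-- The curve `x ↦ T(b - x) u(x)` is continuous with right derivative zero, so its values at `0` and
`b` agree. One-sided derivatives suffice for this. -/
theorem IsSolution.eq_op [CompleteSpace E] {T : C0Semigroup E} {u : ℝ≥0 → E}
    (hu : IsSolution T u) (b : ℝ≥0) : u b = T.op b (u 0) := by
  set v : ℝ → E := fun x => T.op (b - x.toNNReal) (u x.toNNReal) with hv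
  have hcont : Continuous v := by
    rw [continuous_iff_continuousAt]
    intro x
    exact T.tendsto_op_apply
      ((continuous_const.sub continuous_real_toNNReal).tendsto x)
      ((hu.continuous.comp continuous_real_toNNReal).tendsto x)
  have hderiv : ∀ x ∈ Set.Ico (0 : ℝ) b, HasDerivWithinAt v 0 (Set.Ici x) x := by
    intro x hx
    obtain ⟨g, hg, hg'⟩ := hu.tendsto_quot x.toNNReal
    rw [hasDerivWithinAt_iff_tendsto_slope, Set.Ici_sdiff_left]
    -- With `h = y - x` and `T(b - x) = T(b - y) T(h)`, the slope of `v` is `T(b - y)` applied to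
    -- the forward quotient of `u` minus the semigroup quotient of `u(x)`; that difference tends to
    -- `g - g = 0`.
    have h1 := (hg'.sub hg).comp (tendsto_toNNReal_sub_nhdsGT x)
    rw [sub_self] at h1
    have h2 : Tendsto (fun y : ℝ => b - y.toNNReal) (𝓝[>] x) (𝓝 (b - x.toNNReal)) :=
      ((continuous_const.sub continuous_real_toNNReal).tendsto x).mono_left nhdsWithin_le_nhds
    have h3 := T.tendsto_op_apply h2 h1
    rw [map_zero] at h3
    refine h3.congr' ?_
    filter_upwards [self_mem_nhdsWithin, nhdsWithin_le_nhds (Iio_mem_nhds hx.2)] with y hy hyb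
    have hxy : x < y := hy
    have e1 : x.toNNReal + (y - x).toNNReal = y.toNNReal := by
      rw [← Real.toNNReal_add hx.1 (by linarith)]; congr 1; ring
    have e2 : b - y.toNNReal + (y - x).toNNReal = b - x.toNNReal := by
      have hyb' : y.toNNReal ≤ b := Real.toNNReal_le_iff_le_coe.2 (le_of_lt hyb)
      rw [← e1] at hyb' ⊢
      generalize (y - x).toNNReal = h at *
      generalize x.toNNReal = z at *
      obtain ⟨c, hc⟩ := exists_add_of_le hyb'
      rw [hc, add_tsub_cancel_left, add_assoc, add_tsub_cancel_left, add_comm]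
    have e3 : (((y - x).toNNReal : ℝ≥0) : ℝ) = y - x := Real.coe_toNNReal _ (by linarith)
    simp only [slope, vsub_eq_sub, hv, Function.comp, C0Semigroup.quot, forwardQuot, e1, e3,
      ← smul_sub, map_smul, map_sub, C0Semigroup.op_op, e2]
    rw [← Complex.ofReal_inv, Complex.coe_smul]
    congr 1
    abel
  have := constant_of_has_deriv_right_zero (b := (b : ℝ)) hcont.continuousOn hderiv b
    ⟨b.2, le_rfl⟩
  simpa [hv, T.op_zero] using this

namespace C0Semigroup

/-- The mean value of the orbit of `f` over `[0, h]`. -/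
noncomputable def orbitMean (T : C0Semigroup E) (f : E) (h : ℝ) : E :=
  ⨍ s in (0 : ℝ)..h, T.op s.toNNReal f

theorem continuous_orbit_toNNReal (T : C0Semigroup E) (f : E) :
    Continuous fun s : ℝ => T.op s.toNNReal f :=
  (T.continuous_orbit f).comp continuous_real_toNNReal

/-- Applied to `essBall`, this transfers an `L^∞` bound on the orbit to its mean, although the
integral is formed in `L^p`. -/
theorem orbitMean_mem [CompleteSpace E] (T : C0Semigroup E) (f : E) {h : ℝ} (hh : 0 < h)
    {s : Set E} (hs : Convex ℝ s) (hsc : IsClosed s) (hf : ∀ t, T.op t f ∈ s) :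
    T.orbitMean f h ∈ s := by
  rw [orbitMean, Set.uIoc_of_le hh.le]
  refine hs.set_average_mem hsc ?_ ?_ (Eventually.of_forall fun t => hf _) ?_
  · simpa using hh
  · simp
  · exact (T.continuous_orbit_toNNReal f).integrableOn_Ioc

theorem tendsto_integral_orbit [CompleteSpace E] (T : C0Semigroup E) (f : E) (a : ℝ≥0) :
    Tendsto (fun h : ℝ≥0 => ((h : ℝ) : ℂ)⁻¹ • ∫ s in (a : ℝ)..(a + h : ℝ), T.op s.toNNReal f)
      (𝓝[>] 0) (𝓝 (T.op a f)) := by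
  have hc := T.continuous_orbit_toNNReal f
  have hd : HasDerivAt (fun x : ℝ => ∫ s in (a : ℝ)..x, T.op s.toNNReal f)
      (T.op (a : ℝ).toNNReal f) a :=
    intervalIntegral.integral_hasDerivAt_right (hc.intervalIntegrable _ _)
      (hc.stronglyMeasurableAtFilter _ _) hc.continuousAt
  have := hd.hasDerivWithinAt (s := Set.Ici (a : ℝ))
  rw [hasDerivWithinAt_iff_tendsto_slope, Set.Ici_sdiff_left] at this
  have hm : Tendsto (fun h : ℝ≥0 => (a + h : ℝ)) (𝓝[>] 0) (𝓝[>] (a : ℝ)) := by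
    refine tendsto_nhdsWithin_iff.2 ⟨?_, ?_⟩
    · have : Continuous fun h : ℝ≥0 => (a + h : ℝ) := by fun_prop
      simpa using (this.tendsto 0).mono_left nhdsWithin_le_nhds
    · filter_upwards [self_mem_nhdsWithin] with y hy
      simpa using hy
  rw [Real.toNNReal_coe] at this
  refine (this.comp hm).congr fun h => ?_
  simp only [Function.comp, slope, vsub_eq_sub, intervalIntegral.integral_same, sub_zero,
    add_sub_cancel_left]
  rw [← Complex.ofReal_inv, Complex.coe_smul]

theorem tendsto_orbitMean [CompleteSpace E] (T : C0Semigroup E) (f : E) :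
    Tendsto (fun h : ℝ≥0 => T.orbitMean f h) (𝓝[>] 0) (𝓝 f) := by
  have := T.tendsto_integral_orbit f 0
  rw [T.op_zero] at this
  refine this.congr fun h => ?_
  rw [orbitMean, interval_average_eq, ← Complex.ofReal_inv, Complex.coe_smul]
  simp

/-- `T(h)` shifts the integral over `[0, r]` to `[h, r + h]`, so the increment is the integral over
`[r, r + h]` minus that over `[0, h]`; divided by `h` it tends to `T(r)f - f`. -/
theorem orbitMean_mem_domain [CompleteSpace E] (T : C0Semigroup E) (f : E) (r : ℝ≥0) :
    T.orbitMean f r ∈ T.generator.domain := by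
  have hc := T.continuous_orbit_toNNReal f
  have hi : ∀ a b : ℝ, IntervalIntegrable (fun s : ℝ => T.op s.toNNReal f) volume a b :=
    fun a b => hc.intervalIntegrable _ _
  have key : (∫ s in (0 : ℝ)..r, T.op s.toNNReal f) ∈ T.generator.domain := by
    refine ⟨T.op r f - T.op 0 f, ?_⟩
    refine ((T.tendsto_integral_orbit f r).sub (T.tendsto_integral_orbit f 0)).congr fun h => ?_
    rw [quot, ← smul_sub]
    congr 1
    have h1 : T.op h (∫ s in (0 : ℝ)..r, T.op s.toNNReal f) =
        ∫ s in (h : ℝ)..(r + h : ℝ), T.op s.toNNReal f := by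
      rw [← ContinuousLinearMap.intervalIntegral_comp_comm _ (hi _ _)]
      have := intervalIntegral.integral_comp_add_right (a := 0) (b := (r : ℝ))
        (fun s : ℝ => T.op s.toNNReal f) (h : ℝ)
      rw [zero_add] at this
      rw [← this]
      refine intervalIntegral.integral_congr fun s hs => ?_
      rw [Set.uIcc_of_le r.coe_nonneg] at hs
      simp only [op_op]
      rw [Real.toNNReal_add hs.1 h.coe_nonneg, Real.toNNReal_coe, add_comm]
    rw [h1, NNReal.coe_zero, zero_add,
      ← intervalIntegral.integral_interval_sub_left (hi 0 (r + h)) (hi 0 r),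
      ← intervalIntegral.integral_interval_sub_left (hi 0 (r + h)) (hi 0 h)]
    abel
  rw [orbitMean, interval_average_eq, ← Complex.coe_smul]
  exact Submodule.smul_mem _ _ key

end C0Semigroup

end Koopman

/-! ### Bounded functions and their products inside `L^p`. -/

namespace Koopman

variable {X : Type*} [MeasurableSpace X] {μ : Measure X} {p : ℝ≥0∞}

/-- The functions in `L^p` which are bounded by `K` almost everywhere. -/
def essBall (μ : Measure X) (p : ℝ≥0∞) (K : ℝ) : Set (Lp ℂ p μ) := {f | ∀ᵐ x ∂μ, ‖f x‖ ≤ K}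

theorem essBall_mono {K L : ℝ} (h : K ≤ L) : essBall μ p K ⊆ essBall μ p L :=
  fun _ hf => Eventually.mono (show ∀ᵐ _ ∂μ, _ from hf) fun _ hx => le_trans hx h

theorem mem_boundedPart_of_mem_essBall {f : Lp ℂ p μ} {K : ℝ} (hf : f ∈ essBall μ p K) :
    f ∈ boundedPart μ p :=
  memLp_top_of_bound (Lp.aestronglyMeasurable f) K hf

theorem exists_mem_essBall {f : Lp ℂ p μ} (hf : f ∈ boundedPart μ p) :
    ∃ K, 0 ≤ K ∧ f ∈ essBall μ p K := by
  have hf' : MemLp f ∞ μ := hf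
  refine ⟨(eLpNormEssSup f μ).toReal, ENNReal.toReal_nonneg, ?_⟩
  have hfin : eLpNormEssSup f μ ≠ ∞ := by
    rw [← eLpNorm_exponent_top]; exact hf'.2.ne
  filter_upwards [ae_le_eLpNormEssSup (f := f) (μ := μ)] with x hx
  rw [← toReal_enorm]
  exact ENNReal.toReal_mono hfin hx

theorem convex_essBall (K : ℝ) : Convex ℝ (essBall μ p K) := by
  intro f hf g hg a b ha hb hab
  change ∀ᵐ x ∂μ, _
  filter_upwards [hf, hg, Lp.coeFn_add (a • f) (b • g), Lp.coeFn_smul a f, Lp.coeFn_smul b g]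
    with x h1 h2 h3 h4 h5
  rw [h3, Pi.add_apply, h4, h5]
  calc ‖(a • ⇑f) x + (b • ⇑g) x‖ ≤ ‖a • f x‖ + ‖b • g x‖ := norm_add_le _ _
    _ = a * ‖f x‖ + b * ‖g x‖ := by
      rw [norm_smul, norm_smul, Real.norm_of_nonneg ha, Real.norm_of_nonneg hb]
    _ ≤ a * K + b * K := by gcongr
    _ = K := by rw [← add_mul, hab, one_mul]

theorem exists_subseq_tendsto_ae [Fact (1 ≤ p)] {f : ℕ → Lp ℂ p μ} {g : Lp ℂ p μ}
    (h : Tendsto f atTop (𝓝 g)) :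
    ∃ φ : ℕ → ℕ, StrictMono φ ∧ ∀ᵐ x ∂μ, Tendsto (fun n => f (φ n) x) atTop (𝓝 (g x)) :=
  (tendstoInMeasure_of_tendsto_Lp h).exists_seq_tendsto_ae

/-- Norm convergence gives almost everywhere convergence along a subsequence, and this preserves a
pointwise bound. -/
theorem isClosed_essBall [Fact (1 ≤ p)] (K : ℝ) : IsClosed (essBall μ p K) := by
  refine IsSeqClosed.isClosed fun f g hf hfg => ?_
  obtain ⟨φ, -, hφ⟩ := exists_subseq_tendsto_ae hfg
  filter_upwards [hφ, ae_all_iff.2 fun n => hf (φ n)] with x hx hx'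
  exact le_of_tendsto' hx.norm hx'

/-! ### Multiplication by bounded functions -/

theorem mulBounded_eq_iff {f g w : Lp ℂ p μ} (hg : g ∈ boundedPart μ p) :
    mulBounded f g hg = w ↔ ∀ᵐ x ∂μ, f x * g x = w x := by
  rw [Lp.ext_iff]
  constructor <;> intro h <;> filter_upwards [h, coeFn_mulBounded f g hg] with x h1 h2
  · rw [← h2, h1]
  · rw [h2, h1]

theorem norm_mulBounded_le {f g : Lp ℂ p μ} (hg : g ∈ boundedPart μ p) {K : ℝ}
    (hK : g ∈ essBall μ p K) : ‖mulBounded f g hg‖ ≤ K * ‖f‖ := by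
  refine Lp.norm_le_mul_norm_of_ae_le_mul ?_
  filter_upwards [hK, coeFn_mulBounded f g hg] with x h1 h2
  rw [h2, norm_mul, mul_comm]
  gcongr

theorem mulBounded_comm {f g : Lp ℂ p μ} (hf : f ∈ boundedPart μ p) (hg : g ∈ boundedPart μ p) :
    mulBounded f g hg = mulBounded g f hf := by
  rw [mulBounded_eq_iff]
  filter_upwards [coeFn_mulBounded g f hf] with x hx
  rw [hx, mul_comm]

theorem mulBounded_mem_essBall {f g : Lp ℂ p μ} {K L : ℝ} (hf : f ∈ essBall μ p K)
    (hg : g ∈ essBall μ p L) :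
    mulBounded f g (mem_boundedPart_of_mem_essBall hg) ∈ essBall μ p (K * L) := by
  change ∀ᵐ x ∂μ, _
  filter_upwards [hf, hg, coeFn_mulBounded f g (mem_boundedPart_of_mem_essBall hg)] with x h1 h2 h3
  rw [h3, norm_mul]
  have := (norm_nonneg _).trans h1
  gcongr

theorem mulBounded_mem {f g : Lp ℂ p μ} (hf : f ∈ boundedPart μ p) (hg : g ∈ boundedPart μ p) :
    mulBounded f g hg ∈ boundedPart μ p := by
  obtain ⟨K, -, hK⟩ := exists_mem_essBall hf
  obtain ⟨L, -, hL⟩ := exists_mem_essBall hg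
  exact mem_boundedPart_of_mem_essBall (mulBounded_mem_essBall hK hL)

/-- Multiplication by a bounded function as a continuous linear map. -/
noncomputable def mulBoundedCLM [Fact (1 ≤ p)] (g : Lp ℂ p μ) (hg : g ∈ boundedPart μ p) :
    Lp ℂ p μ →L[ℂ] Lp ℂ p μ :=
  LinearMap.mkContinuous
    { toFun := fun f => mulBounded f g hg
      map_add' := by
        intro f f'
        rw [mulBounded_eq_iff]
        filter_upwards [Lp.coeFn_add f f', Lp.coeFn_add (mulBounded f g hg) (mulBounded f' g hg),
          coeFn_mulBounded f g hg, coeFn_mulBounded f' g hg] with x h1 h2 h3 h4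
        rw [h1, h2, Pi.add_apply, Pi.add_apply, h3, h4, add_mul]
      map_smul' := by
        intro c f
        rw [mulBounded_eq_iff]
        filter_upwards [Lp.coeFn_smul c f, Lp.coeFn_smul c (mulBounded f g hg),
          coeFn_mulBounded f g hg] with x h1 h2 h3
        rw [h1, RingHom.id_apply, h2, Pi.smul_apply, Pi.smul_apply, h3, smul_mul_assoc] }
    (exists_mem_essBall hg).choose
    fun _ => norm_mulBounded_le hg (exists_mem_essBall hg).choose_spec.2

theorem mulBoundedCLM_apply [Fact (1 ≤ p)] (f g : Lp ℂ p μ) (hg : g ∈ boundedPart μ p) :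
    mulBoundedCLM g hg f = mulBounded f g hg := rfl

theorem mulBounded_sub_right {f g g' : Lp ℂ p μ} (hg : g ∈ boundedPart μ p)
    (hg' : g' ∈ boundedPart μ p) :
    mulBounded f (g - g') (sub_mem hg hg') = mulBounded f g hg - mulBounded f g' hg' := by
  rw [mulBounded_eq_iff]
  filter_upwards [Lp.coeFn_sub g g', Lp.coeFn_sub (mulBounded f g hg) (mulBounded f g' hg'),
    coeFn_mulBounded f g hg, coeFn_mulBounded f g' hg'] with x h1 h2 h3 h4
  rw [h1, h2, Pi.sub_apply, Pi.sub_apply, h3, h4, mul_sub]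

/-! ### Density of bounded functions -/

section Dense

variable [IsFiniteMeasure μ]

theorem indicatorConstLp_mem_essBall {s : Set X} (hs : MeasurableSet s) :
    indicatorConstLp p hs (measure_ne_top μ s) (1 : ℂ) ∈ essBall μ p 1 := by
  change ∀ᵐ x ∂μ, _
  filter_upwards [indicatorConstLp_coeFn (p := p) (hs := hs) (hμs := measure_ne_top μ s)
    (c := (1 : ℂ))] with x hx
  rw [hx]
  by_cases h : x ∈ s <;> simp [h]

theorem const_one_eq_indicatorConstLp :
    Lp.const p μ (1 : ℂ) = indicatorConstLp p MeasurableSet.univ (measure_ne_top μ _) (1 : ℂ) := by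
  rw [indicatorConstLp_univ]

theorem indicatorConstLp_eq_smul {s : Set X} (hs : MeasurableSet s) (c : ℂ) :
    indicatorConstLp p hs (measure_ne_top μ s) c =
      c • indicatorConstLp p hs (measure_ne_top μ s) (1 : ℂ) := by
  refine Lp.ext ?_
  filter_upwards [indicatorConstLp_coeFn (p := p) (hs := hs) (hμs := measure_ne_top μ s)
    (c := (1 : ℂ)), indicatorConstLp_coeFn (p := p) (hs := hs) (hμs := measure_ne_top μ s)
    (c := c), Lp.coeFn_smul c (indicatorConstLp p hs (measure_ne_top μ s) (1 : ℂ))] with x h1 h2 h3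
  rw [h2, h3, Pi.smul_apply, h1]
  by_cases h : x ∈ s <;> simp [h]

variable [Fact (1 ≤ p)]

theorem dense_boundedPart (hp : p ≠ ∞) : Dense (boundedPart μ p : Set (Lp ℂ p μ)) := by
  intro f
  change f ∈ (boundedPart μ p).topologicalClosure
  refine Lp.induction hp (fun f => f ∈ (boundedPart μ p).topologicalClosure) ?_ ?_ ?_ f
  · intro c s hs hμs
    rw [Lp.simpleFunc.coe_indicatorConst, indicatorConstLp_eq_smul]
    exact Submodule.smul_mem _ _ (Submodule.le_topologicalClosure _
      (mem_boundedPart_of_mem_essBall (indicatorConstLp_mem_essBall hs)))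
  · intro f g hf hg _ hf' hg'
    exact add_mem hf' hg'
  · exact Submodule.isClosed_topologicalClosure _

/-- Products converge in `L^p` if both factors do and the second one stays bounded. -/
theorem tendsto_mulBounded (hp : p ≠ ∞) {ι : Type*} {l : Filter ι} {f g : ι → Lp ℂ p μ}
    {f₀ g₀ : Lp ℂ p μ} (hg : ∀ i, g i ∈ boundedPart μ p) (hg₀ : g₀ ∈ boundedPart μ p)
    (hf : Tendsto f l (𝓝 f₀)) (hgl : Tendsto g l (𝓝 g₀)) {K : ℝ}
    (hK : ∀ᶠ i in l, g i ∈ essBall μ p K) :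
    Tendsto (fun i => mulBounded (f i) (g i) (hg i)) l (𝓝 (mulBounded f₀ g₀ hg₀)) := by
  obtain ⟨K₀, hK₀, hgK₀⟩ := exists_mem_essBall hg₀
  -- `C` bounds `g i - g₀`; nothing is assumed on the sign of `K`, hence the maximum.
  set C := max K 0 + K₀ with hC
  have hC0 : 0 ≤ C := by positivity
  have hd : ∀ i, g i - g₀ ∈ boundedPart μ p := fun i => sub_mem (hg i) hg₀
  have hKC : ∀ᶠ i in l, g i - g₀ ∈ essBall μ p C := by
    filter_upwards [hK] with i hi
    change ∀ᵐ x ∂μ, _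
    filter_upwards [hi, hgK₀, Lp.coeFn_sub (g i) g₀] with x h1 h2 h3
    rw [h3]
    exact (norm_sub_le _ _).trans (add_le_add (h1.trans (le_max_left _ _)) h2)
  -- The splitting is `f g - f₀ g₀ = (f - f₀) g + f₀ (g - g₀)`.
  have hA : Tendsto (fun i => mulBounded (f i - f₀) (g i) (hg i)) l (𝓝 0) := by
    have h0 : Tendsto (fun i => K * ‖f i - f₀‖) l (𝓝 0) := by
      simpa using (tendsto_iff_norm_sub_tendsto_zero.1 hf).const_mul K
    refine squeeze_zero_norm' ?_ h0
    filter_upwards [hK] with i hi using norm_mulBounded_le _ hi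
  have hB : Tendsto (fun i => mulBounded f₀ (g i - g₀) (hd i)) l (𝓝 0) := by
    rw [Metric.tendsto_nhds]
    intro ε hε
    -- `f₀` may be unbounded, so it is replaced by a bounded `b`: the error costs at most `C` times
    -- `‖f₀ - b‖`, and `b (g - g₀)` tends to zero. The denominator uses `C + 1` since `C` may
    -- vanish.
    obtain ⟨b, hbd, hb⟩ := Metric.mem_closure_iff.1 (dense_boundedPart (μ := μ) hp f₀)
      (ε / (2 * (C + 1))) (by positivity)
    obtain ⟨M, hM, hbM⟩ := exists_mem_essBall hbd
    have h0 : Tendsto (fun i => M * ‖g i - g₀‖) l (𝓝 0) := by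
      simpa using (tendsto_iff_norm_sub_tendsto_zero.1 hgl).const_mul M
    filter_upwards [hKC, h0.eventually (gt_mem_nhds (half_pos hε))] with i h1 h2
    rw [dist_zero_right]
    have e : mulBounded f₀ (g i - g₀) (hd i) =
        mulBounded (f₀ - b) (g i - g₀) (hd i) + mulBounded (g i - g₀) b hbd := by
      rw [← mulBounded_comm hbd (hd i)]
      simp only [← mulBoundedCLM_apply, ← map_add, sub_add_cancel]
    rw [e]
    have h3 : ‖mulBounded (f₀ - b) (g i - g₀) (hd i)‖ ≤ C * (ε / (2 * (C + 1))) := by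
      refine (norm_mulBounded_le _ h1).trans ?_
      gcongr
      rw [← dist_eq_norm]; exact hb.le
    have h4 : C * (ε / (2 * (C + 1))) ≤ ε / 2 := by
      rw [mul_div_assoc', div_le_div_iff₀ (by positivity) (by norm_num)]
      nlinarith
    calc _ ≤ _ := norm_add_le _ _
      _ ≤ C * (ε / (2 * (C + 1))) + M * ‖g i - g₀‖ := add_le_add h3 (norm_mulBounded_le _ hbM)
      _ < ε := by linarith
  have := (hA.add hB).add_const (mulBounded f₀ g₀ hg₀)
  rw [add_zero, zero_add] at this
  refine this.congr fun i => ?_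
  rw [mulBounded_sub_right (hg i) hg₀]
  simp only [← mulBoundedCLM_apply, map_sub]
  abel

end Dense

/-! ### Complex conjugation, modulus and integral -/

theorem star_eq_iff {f w : Lp ℂ p μ} : star f = w ↔ ∀ᵐ x ∂μ, star (f x) = w x := by
  rw [Lp.ext_iff]
  constructor <;> intro h <;> filter_upwards [h, Lp.coeFn_star f] with x h1 h2
  · rw [← h1, h2, Pi.star_apply]
  · rw [h2, Pi.star_apply, h1]

theorem star_sub_Lp (f g : Lp ℂ p μ) : star (f - g) = star f - star g := by
  rw [star_eq_iff]
  filter_upwards [Lp.coeFn_sub f g, Lp.coeFn_sub (star f) (star g), Lp.coeFn_star f,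
    Lp.coeFn_star g] with x h1 h2 h3 h4
  rw [h1, h2, Pi.sub_apply, Pi.sub_apply, h3, h4, star_sub, Pi.star_apply, Pi.star_apply]

theorem star_add_Lp (f g : Lp ℂ p μ) : star (f + g) = star f + star g := by
  rw [star_eq_iff]
  filter_upwards [Lp.coeFn_add f g, Lp.coeFn_add (star f) (star g), Lp.coeFn_star f,
    Lp.coeFn_star g] with x h1 h2 h3 h4
  rw [h1, h2, Pi.add_apply, Pi.add_apply, h3, h4, star_add, Pi.star_apply, Pi.star_apply]

theorem star_smul_Lp (c : ℂ) (f : Lp ℂ p μ) : star (c • f) = star c • star f := by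
  rw [star_eq_iff]
  filter_upwards [Lp.coeFn_smul c f, Lp.coeFn_smul (star c) (star f), Lp.coeFn_star f]
    with x h1 h2 h3
  rw [h1, h2, Pi.smul_apply, Pi.smul_apply, h3, star_smul, Pi.star_apply]

theorem star_mem_essBall {f : Lp ℂ p μ} {K : ℝ} (hf : f ∈ essBall μ p K) :
    star f ∈ essBall μ p K := by
  change ∀ᵐ x ∂μ, _
  filter_upwards [hf, Lp.coeFn_star f] with x h1 h2
  simpa [h2] using h1

theorem star_mem_boundedPart {f : Lp ℂ p μ} (hf : f ∈ boundedPart μ p) :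
    star f ∈ boundedPart μ p := by
  obtain ⟨K, -, hK⟩ := exists_mem_essBall hf
  exact mem_boundedPart_of_mem_essBall (star_mem_essBall hK)

theorem continuous_star_Lp [Fact (1 ≤ p)] : Continuous (star : Lp ℂ p μ → Lp ℂ p μ) := by
  refine (LipschitzWith.of_dist_le_mul (K := 1) fun f g => ?_).continuous
  rw [dist_eq_norm, dist_eq_norm, ← star_sub_Lp, NNReal.coe_one]
  refine Lp.norm_le_mul_norm_of_ae_le_mul ?_
  filter_upwards [Lp.coeFn_star (f - g)] with x hx
  simp [hx]

theorem continuous_modulus [Fact (1 ≤ p)] : Continuous (modulus : Lp ℂ p μ → Lp ℂ p μ) := by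
  unfold modulus
  exact LipschitzWith.continuous_compLp _ _

theorem modulus_eq_iff {f w : Lp ℂ p μ} :
    modulus f = w ↔ ∀ᵐ x ∂μ, ((‖f x‖ : ℝ) : ℂ) = w x := by
  rw [Lp.ext_iff]
  constructor <;> intro h <;> filter_upwards [h, coeFn_modulus f] with x h1 h2
  · rw [← h2, h1]
  · rw [h2, h1]

theorem nonneg_iff_modulus_eq {f : Lp ℂ p μ} : Nonneg f ↔ modulus f = f := by
  rw [modulus_eq_iff, Nonneg]
  refine eventually_congr (Eventually.of_forall fun x => ?_)
  constructor
  · rintro ⟨h1, h2⟩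
    have : f x = ((f x).re : ℂ) := Complex.ext (by simp) (by simpa using h2)
    rw [this, Complex.norm_real, Real.norm_of_nonneg h1]
  · intro h
    rw [← h]
    simp

/-- The integral as a continuous functional on `L^p`. -/
noncomputable def integralCLM [IsProbabilityMeasure μ] [Fact (1 ≤ p)] : Lp ℂ p μ →L[ℂ] ℂ :=
  LinearMap.mkContinuous
    { toFun := fun f => ∫ x, f x ∂μ
      map_add' := by
        intro f g
        rw [integral_congr_ae (Lp.coeFn_add f g)]
        exact integral_add ((Lp.memLp f).integrable Fact.out) ((Lp.memLp g).integrable Fact.out)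
      map_smul' := by
        intro c f
        rw [integral_congr_ae (Lp.coeFn_smul c f)]
        exact integral_smul c _ }
    1 (by
      intro f
      have h1 := enorm_integral_le_lintegral_enorm (μ := μ) (f := f)
      rw [← eLpNorm_one_eq_lintegral_enorm] at h1
      have h2 := h1.trans (eLpNorm_le_eLpNorm_of_exponent_le (Fact.out : 1 ≤ p)
        (Lp.aestronglyMeasurable f))
      rw [one_mul, Lp.norm_def]
      have := ENNReal.toReal_mono (Lp.eLpNorm_ne_top f) h2
      simpa using this)

theorem integralCLM_apply [IsProbabilityMeasure μ] [Fact (1 ≤ p)] (f : Lp ℂ p μ) :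
    integralCLM f = ∫ x, f x ∂μ := rfl

end Koopman

/-! ### Indicators, and operators that preserve them. -/

namespace Koopman

variable {X : Type*} [MeasurableSpace X] {μ : Measure X} {p : ℝ≥0∞}

/-- The indicator function of a measurable set in `L^p`. -/
noncomputable def ind (μ : Measure X) [IsFiniteMeasure μ] (p : ℝ≥0∞) {s : Set X}
    (hs : MeasurableSet s) : Lp ℂ p μ :=
  indicatorConstLp p hs (measure_ne_top μ s) (1 : ℂ)

section Indicator

variable [IsFiniteMeasure μ]

theorem indicator_mk {s : Set X} (hs : MeasurableSet s) :
    (MeasureAlgebra.mk μ s hs).indicator p = ind μ p hs := rfl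

theorem coeFn_ind {s : Set X} (hs : MeasurableSet s) :
    ∀ᵐ x ∂μ, ind μ p hs x = s.indicator (fun _ => (1 : ℂ)) x :=
  indicatorConstLp_coeFn

theorem ind_mem_essBall {s : Set X} (hs : MeasurableSet s) : ind μ p hs ∈ essBall μ p 1 :=
  indicatorConstLp_mem_essBall hs

theorem ind_mem {s : Set X} (hs : MeasurableSet s) : ind μ p hs ∈ boundedPart μ p :=
  mem_boundedPart_of_mem_essBall (ind_mem_essBall hs)

theorem const_one_eq_ind : Lp.const p μ (1 : ℂ) = ind μ p MeasurableSet.univ :=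
  const_one_eq_indicatorConstLp

theorem coeFn_const_one : ∀ᵐ x ∂μ, (Lp.const p μ (1 : ℂ)) x = 1 := by
  rw [const_one_eq_ind]
  filter_upwards [coeFn_ind (μ := μ) (p := p) MeasurableSet.univ] with x hx
  simpa using hx

theorem ind_eq_ind_iff {s t : Set X} (hs : MeasurableSet s) (ht : MeasurableSet t) :
    ind μ p hs = ind μ p ht ↔ s =ᵐ[μ] t := by
  constructor
  · intro h
    filter_upwards [coeFn_ind (μ := μ) (p := p) hs, coeFn_ind (μ := μ) (p := p) ht] with x h1 h2
    rw [h, h2] at h1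
    apply propext
    change x ∈ s ↔ x ∈ t
    by_cases hxs : x ∈ s <;> by_cases hxt : x ∈ t <;> simp_all
  · intro h
    refine Lp.ext ?_
    filter_upwards [coeFn_ind (μ := μ) (p := p) hs, coeFn_ind (μ := μ) (p := p) ht,
      indicator_ae_eq_of_ae_eq_set (f := fun _ => (1 : ℂ)) h] with x h1 h2 h3
    rw [h1, h2, h3]

theorem mulBounded_ind {s t : Set X} (hs : MeasurableSet s) (ht : MeasurableSet t) :
    mulBounded (ind μ p hs) (ind μ p ht) (ind_mem ht) = ind μ p (hs.inter ht) := by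
  rw [mulBounded_eq_iff]
  filter_upwards [coeFn_ind (μ := μ) (p := p) hs, coeFn_ind (μ := μ) (p := p) ht,
    coeFn_ind (μ := μ) (p := p) (hs.inter ht)] with x h1 h2 h3
  rw [h1, h2, h3]
  by_cases hxs : x ∈ s <;> by_cases hxt : x ∈ t <;> simp_all

theorem integral_ind {s : Set X} (hs : MeasurableSet s) :
    ∫ x, ind μ p hs x ∂μ = ((μ s).toReal : ℂ) := by
  rw [integral_congr_ae (coeFn_ind hs), integral_indicator hs]
  simp [Measure.real]

theorem star_ind {s : Set X} (hs : MeasurableSet s) : star (ind μ p hs) = ind μ p hs := by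
  rw [star_eq_iff]
  filter_upwards [coeFn_ind (μ := μ) (p := p) hs] with x h1
  rw [h1]
  by_cases hxs : x ∈ s <;> simp_all

theorem modulus_smul_ind {s : Set X} (hs : MeasurableSet s) (c : ℂ) :
    modulus (c • ind μ p hs) = ((‖c‖ : ℝ) : ℂ) • ind μ p hs := by
  rw [modulus_eq_iff]
  filter_upwards [coeFn_ind (μ := μ) (p := p) hs, Lp.coeFn_smul c (ind μ p hs),
    Lp.coeFn_smul ((‖c‖ : ℝ) : ℂ) (ind μ p hs)] with x h1 h2 h3
  rw [h2, h3, Pi.smul_apply, Pi.smul_apply, h1]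
  by_cases hxs : x ∈ s <;> simp_all

theorem nonneg_ind {s : Set X} (hs : MeasurableSet s) : Nonneg (ind μ p hs) := by
  filter_upwards [coeFn_ind (μ := μ) (p := p) hs] with x hx
  rw [hx]
  by_cases h : x ∈ s <;> simp [h]

variable [Fact (1 ≤ p)]

/-- The additive step may assume disjoint supports, which is where the modulus is additive. -/
theorem Lp_ind_induction (hp : p ≠ ∞) (P : Lp ℂ p μ → Prop)
    (hind : ∀ (c : ℂ) {s : Set X} (hs : MeasurableSet s), P (c • ind μ p hs))
    (hadd : ∀ f g : Lp ℂ p μ, (∀ᵐ x ∂μ, f x = 0 ∨ g x = 0) → P f → P g → P (f + g))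
    (hclosed : IsClosed {f | P f}) (f : Lp ℂ p μ) : P f := by
  refine Lp.induction hp P ?_ ?_ hclosed f
  · intro c s hs hμs
    rw [Lp.simpleFunc.coe_indicatorConst, indicatorConstLp_eq_smul]
    exact hind c hs
  · intro f g hf hg hd h1 h2
    refine hadd _ _ ?_ h1 h2
    filter_upwards [hf.coeFn_toLp, hg.coeFn_toLp] with x hx hx'
    rw [hx, hx']
    by_contra! hne
    exact Set.disjoint_left.1 hd hne.1 hne.2

theorem clm_ext_ind (hp : p ≠ ∞) {F : Type*} [NormedAddCommGroup F] [NormedSpace ℂ F]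
    {A B : Lp ℂ p μ →L[ℂ] F}
    (h : ∀ {s : Set X} (hs : MeasurableSet s), A (ind μ p hs) = B (ind μ p hs)) : A = B := by
  ext1 f
  refine Lp_ind_induction hp (fun f => A f = B f) ?_ ?_ ?_ f
  · intro c s hs
    rw [map_smul, map_smul, h hs]
  · intro f g _ h1 h2
    rw [map_add, map_add, h1, h2]
  · exact isClosed_eq A.continuous B.continuous

end Indicator

theorem modulus_add {f g : Lp ℂ p μ} (h : ∀ᵐ x ∂μ, f x = 0 ∨ g x = 0) :
    modulus (f + g) = modulus f + modulus g := by
  rw [modulus_eq_iff]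
  filter_upwards [h, Lp.coeFn_add f g, Lp.coeFn_add (modulus f) (modulus g), coeFn_modulus f,
    coeFn_modulus g] with x h1 h2 h3 h4 h5
  rw [h2, h3, Pi.add_apply, Pi.add_apply, h4, h5]
  rcases h1 with h1 | h1 <;> simp [h1]

/-- An operator which maps indicator functions to indicator functions and is compatible with
intersections. -/
def MapsIndicators [IsFiniteMeasure μ] [Fact (1 ≤ p)] (S : Lp ℂ p μ →L[ℂ] Lp ℂ p μ) : Prop :=
  ∀ ⦃s s' : Set X⦄ (hs : MeasurableSet s) (hs' : MeasurableSet s'),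
    ∃ (t t' : Set X) (ht : MeasurableSet t) (ht' : MeasurableSet t'),
      S (ind μ p hs) = ind μ p ht ∧ S (ind μ p hs') = ind μ p ht' ∧
        S (ind μ p (hs.inter hs')) = ind μ p (ht.inter ht')

namespace MapsIndicators

variable [IsFiniteMeasure μ] [Fact (1 ≤ p)] {S : Lp ℂ p μ →L[ℂ] Lp ℂ p μ}

theorem exists_eq (hS : MapsIndicators S) {s : Set X} (hs : MeasurableSet s) :
    ∃ (t : Set X) (ht : MeasurableSet t), S (ind μ p hs) = ind μ p ht := by
  obtain ⟨t, _, ht, _, h, _⟩ := hS hs hs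
  exact ⟨t, ht, h⟩

theorem map_ind_mem (hS : MapsIndicators S) {s : Set X} (hs : MeasurableSet s) :
    S (ind μ p hs) ∈ boundedPart μ p := by
  obtain ⟨t, ht, h⟩ := hS.exists_eq hs
  rw [h]
  exact ind_mem ht

theorem map_mul_ind (hS : MapsIndicators S) (hp : p ≠ ∞) (f : Lp ℂ p μ) {s : Set X}
    (hs : MeasurableSet s) :
    S (mulBounded f (ind μ p hs) (ind_mem hs)) =
      mulBounded (S f) (S (ind μ p hs)) (hS.map_ind_mem hs) := by
  have : S.comp (mulBoundedCLM (ind μ p hs) (ind_mem hs)) =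
      (mulBoundedCLM (S (ind μ p hs)) (hS.map_ind_mem hs)).comp S := by
    refine clm_ext_ind hp fun {s'} hs' => ?_
    obtain ⟨t', t, ht', ht, h1, h2, h3⟩ := hS hs' hs
    simp only [ContinuousLinearMap.comp_apply, mulBoundedCLM_apply, h1, h2, mulBounded_ind, h3]
  exact DFunLike.congr_fun this f

/-- For fixed `f` both sides are continuous and linear in `g`, so indicators `g` suffice; that case
is `map_mul_ind`, proved by the same argument in the other factor. -/
theorem map_mul (hS : MapsIndicators S) (hp : p ≠ ∞) {f g : Lp ℂ p μ} (hf : f ∈ boundedPart μ p)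
    (hSf : S f ∈ boundedPart μ p) (hg : g ∈ boundedPart μ p) (hSg : S g ∈ boundedPart μ p) :
    S (mulBounded f g hg) = mulBounded (S f) (S g) hSg := by
  have : S.comp (mulBoundedCLM f hf) = (mulBoundedCLM (S f) hSf).comp S := by
    refine clm_ext_ind hp fun {s} hs => ?_
    simp only [ContinuousLinearMap.comp_apply, mulBoundedCLM_apply]
    rw [mulBounded_comm (ind_mem hs) hf, hS.map_mul_ind hp,
      mulBounded_comm hSf (hS.map_ind_mem hs)]
  have := DFunLike.congr_fun this g
  simp only [ContinuousLinearMap.comp_apply, mulBoundedCLM_apply] at this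
  rw [mulBounded_comm hf hg, this, mulBounded_comm hSg hSf]

theorem map_star (hS : MapsIndicators S) (hp : p ≠ ∞) (f : Lp ℂ p μ) :
    S (star f) = star (S f) := by
  refine Lp_ind_induction hp (fun f => S (star f) = star (S f)) ?_ ?_ ?_ f
  · intro c s hs
    obtain ⟨t, ht, h⟩ := hS.exists_eq hs
    rw [star_smul_Lp, map_smul, map_smul, star_smul_Lp, star_ind, h, star_ind]
  · intro f g _ h1 h2
    rw [star_add_Lp, map_add, map_add, star_add_Lp, h1, h2]
  · exact isClosed_eq (S.continuous.comp continuous_star_Lp) (continuous_star_Lp.comp S.continuous)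

/-- With `s = {f ≠ 0}`, disjointness reads `f 𝟙_s = f` and `g 𝟙_s = 0`. Applying `S`, with `S 𝟙_s =
𝟙_t`, confines `S f` to `t` and makes `S g` vanish there. -/
theorem map_disjoint (hS : MapsIndicators S) (hp : p ≠ ∞) {f g : Lp ℂ p μ}
    (h : ∀ᵐ x ∂μ, f x = 0 ∨ g x = 0) : ∀ᵐ x ∂μ, S f x = 0 ∨ S g x = 0 := by
  set s : Set X := {x | f x ≠ 0} with hsdef
  have hs : MeasurableSet s :=
    ((Lp.stronglyMeasurable f).measurable (measurableSet_singleton 0)).compl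
  have hf : mulBounded f (ind μ p hs) (ind_mem hs) = f := by
    rw [mulBounded_eq_iff]
    filter_upwards [coeFn_ind (μ := μ) (p := p) hs] with x h1
    rw [h1]
    by_cases hx : f x = 0 <;> simp [hsdef, hx]
  have hg : mulBounded g (ind μ p hs) (ind_mem hs) = 0 := by
    rw [mulBounded_eq_iff]
    filter_upwards [coeFn_ind (μ := μ) (p := p) hs, h, Lp.coeFn_zero ℂ p μ] with x h1 h2 h3
    rw [h1, h3]
    by_cases hx : f x = 0
    · simp [hsdef, hx]
    · simp [hsdef, h2.resolve_left hx]
  obtain ⟨t, ht, hst⟩ := hS.exists_eq hs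
  have hf' := hS.map_mul_ind hp f hs
  have hg' := hS.map_mul_ind hp g hs
  rw [hf] at hf'
  rw [hg, map_zero] at hg'
  have hf'' := (mulBounded_eq_iff _).1 hf'.symm
  have hg'' := (mulBounded_eq_iff _).1 hg'.symm
  rw [hst] at hf'' hg''
  filter_upwards [hf'', hg'', coeFn_ind (μ := μ) (p := p) ht, Lp.coeFn_zero ℂ p μ]
    with x h1 h2 h3 h4
  rw [h3] at h1 h2
  by_cases hx : x ∈ t
  · right; rw [h4] at h2; simpa [hx] using h2
  · left; simpa [hx] using h1.symm

theorem map_modulus (hS : MapsIndicators S) (hp : p ≠ ∞) (f : Lp ℂ p μ) :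
    modulus (S f) = S (modulus f) := by
  refine Lp_ind_induction hp (fun f => modulus (S f) = S (modulus f)) ?_ ?_ ?_ f
  · intro c s hs
    obtain ⟨t, ht, h⟩ := hS.exists_eq hs
    rw [map_smul, h, modulus_smul_ind, modulus_smul_ind, map_smul, h]
  · intro f g hd h1 h2
    rw [map_add, modulus_add hd, modulus_add (hS.map_disjoint hp hd), map_add, h1, h2]
  · exact isClosed_eq (continuous_modulus.comp S.continuous) (S.continuous.comp continuous_modulus)

end MapsIndicators

theorem nonneg_map_of_modulus_map [Fact (1 ≤ p)] {S : Lp ℂ p μ →L[ℂ] Lp ℂ p μ}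
    (h : ∀ f, modulus (S f) = S (modulus f)) {f : Lp ℂ p μ} (hf : Nonneg f) : Nonneg (S f) := by
  rw [nonneg_iff_modulus_eq] at hf ⊢
  rw [h, hf]

section HomToMarkov

variable [IsProbabilityMeasure μ] [Fact (1 ≤ p)] {S : Lp ℂ p μ →L[ℂ] Lp ℂ p μ}

theorem mapsIndicators_of_measureAlgebraHom (θ : MeasureAlgebraHom μ)
    (h : ∀ M : MeasureAlgebra μ, S (M.indicator p) = (θ.toLatticeHom M).indicator p) :
    MapsIndicators S := by
  intro s s' hs hs'
  obtain ⟨⟨t, ht⟩, hθ⟩ := Quotient.exists_rep (θ.toLatticeHom (MeasureAlgebra.mk μ s hs))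
  obtain ⟨⟨t', ht'⟩, hθ'⟩ := Quotient.exists_rep (θ.toLatticeHom (MeasureAlgebra.mk μ s' hs'))
  refine ⟨t, t', ht, ht', ?_, ?_, ?_⟩
  · rw [← indicator_mk, h, ← hθ]; rfl
  · rw [← indicator_mk, h, ← hθ']; rfl
  · have : MeasureAlgebra.mk μ (s ∩ s') (hs.inter hs') =
        MeasureAlgebra.mk μ s hs ⊓ MeasureAlgebra.mk μ s' hs' := rfl
    have e : θ.toLatticeHom (MeasureAlgebra.mk μ s hs ⊓ MeasureAlgebra.mk μ s' hs') =
        θ.toLatticeHom (MeasureAlgebra.mk μ s hs) ⊓ θ.toLatticeHom (MeasureAlgebra.mk μ s' hs') :=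
      θ.map_inf' _ _
    rw [← indicator_mk, h, this, e, ← hθ, ← hθ']; rfl

theorem isMarkovLatticeOperator_of_measureAlgebraHom (hp : p ≠ ∞) (θ : MeasureAlgebraHom μ)
    (h : ∀ M : MeasureAlgebra μ, S (M.indicator p) = (θ.toLatticeHom M).indicator p) :
    IsMarkovLatticeOperator S := by
  have hS := mapsIndicators_of_measureAlgebraHom θ h
  have hmeas : ∀ {s : Set X} (hs : MeasurableSet s), ∃ (t : Set X) (ht : MeasurableSet t),
      S (ind μ p hs) = ind μ p ht ∧ μ t = μ s := by
    intro s hs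
    obtain ⟨⟨t, ht⟩, hθ⟩ := Quotient.exists_rep (θ.toLatticeHom (MeasureAlgebra.mk μ s hs))
    refine ⟨t, ht, ?_, ?_⟩
    · rw [← indicator_mk, h, ← hθ]; rfl
    · have h2 := θ.measure_map (MeasureAlgebra.mk μ s hs)
      change (θ.toLatticeHom (MeasureAlgebra.mk μ s hs)).measure = _ at h2
      rw [← hθ] at h2
      exact h2
  have hmod := hS.map_modulus hp
  refine ⟨fun f => nonneg_map_of_modulus_map hmod, hmod, ?_, ?_⟩
  · obtain ⟨t, ht, h1, h2⟩ := hmeas MeasurableSet.univ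
    rw [const_one_eq_ind, h1, ind_eq_ind_iff, ae_eq_univ_iff_measure_eq ht.nullMeasurableSet, h2]
  · have : integralCLM.comp S = (integralCLM : Lp ℂ p μ →L[ℂ] ℂ) := by
      refine clm_ext_ind hp fun {s} hs => ?_
      obtain ⟨t, ht, h1, h2⟩ := hmeas hs
      rw [ContinuousLinearMap.comp_apply, h1, integralCLM_apply, integralCLM_apply, integral_ind,
        integral_ind, h2]
    exact fun f => DFunLike.congr_fun this f

end HomToMarkov

/-! ### From Markov lattice operators to measure algebra homomorphisms. -/

namespace IsMarkovLatticeOperator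

variable [IsFiniteMeasure μ] [Fact (1 ≤ p)] {S : Lp ℂ p μ →L[ℂ] Lp ℂ p μ}

/-- The images `a`, `b` of `𝟙_s` and of the indicator of the complement satisfy `a + b = 1` and `|a
- b| = 1`. Since `a` is real, `|2a - 1| = 1` leaves only the values `0` and `1`. -/
theorem exists_ind (hS : IsMarkovLatticeOperator S) {s : Set X} (hs : MeasurableSet s) :
    ∃ (t : Set X) (ht : MeasurableSet t), S (ind μ p hs) = ind μ p ht := by
  set a := S (ind μ p hs) with ha
  set b := S (ind μ p hs.compl) with hb
  have hadd : a + b = Lp.const p μ (1 : ℂ) := by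
    rw [ha, hb, ← map_add, ← hS.map_one]
    congr 1
    refine Lp.ext ?_
    filter_upwards [coeFn_ind (μ := μ) (p := p) hs, coeFn_ind (μ := μ) (p := p) hs.compl,
      Lp.coeFn_add (ind μ p hs) (ind μ p hs.compl), coeFn_const_one (μ := μ) (p := p)]
      with x h1 h2 h3 h4
    rw [h3, h4, Pi.add_apply, h1, h2]
    by_cases h : x ∈ s <;> simp [h]
  have hsub : modulus (a - b) = Lp.const p μ (1 : ℂ) := by
    rw [ha, hb, ← map_sub, hS.modulus_map, ← hS.map_one]
    congr 1
    rw [modulus_eq_iff]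
    filter_upwards [coeFn_ind (μ := μ) (p := p) hs, coeFn_ind (μ := μ) (p := p) hs.compl,
      Lp.coeFn_sub (ind μ p hs) (ind μ p hs.compl), coeFn_const_one (μ := μ) (p := p)]
      with x h1 h2 h3 h4
    rw [h3, h4, Pi.sub_apply, h1, h2]
    by_cases h : x ∈ s <;> simp [h]
  have hdich : ∀ᵐ x ∂μ, a x = 0 ∨ a x = 1 := by
    filter_upwards [hS.nonneg _ (nonneg_ind hs), hS.nonneg _ (nonneg_ind hs.compl),
      modulus_eq_iff.1 hsub, Lp.coeFn_add a b, Lp.coeFn_sub a b,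
      coeFn_const_one (μ := μ) (p := p)] with x h1 h2 h3 h4 h5 h6
    rw [hadd, h6, Pi.add_apply] at h4
    rw [h5, h6, Pi.sub_apply] at h3
    rw [← ha] at h1
    have hbx : b x = 1 - a x := by rw [h4]; ring
    have hax : a x = ((a x).re : ℂ) := Complex.ext (by simp) (by simpa using h1.2)
    have e : a x - b x = ((2 * (a x).re - 1 : ℝ) : ℂ) := by
      rw [hbx]; push_cast; rw [← hax]; ring
    rw [e, Complex.norm_real, Complex.ofReal_eq_one, Real.norm_eq_abs,
      abs_eq zero_le_one] at h3
    rcases h3 with h3 | h3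
    · right; rw [hax, Complex.ofReal_eq_one]; linarith
    · left; rw [hax, Complex.ofReal_eq_zero]; linarith
  have ht : MeasurableSet {x | a x = 1} :=
    (Lp.stronglyMeasurable a).measurable (measurableSet_singleton 1)
  refine ⟨_, ht, Lp.ext ?_⟩
  filter_upwards [hdich, coeFn_ind (μ := μ) (p := p) ht] with x h1 h2
  rw [h2]
  rcases h1 with h1 | h1 <;> simp [h1]

theorem ae_le_of_subset (hS : IsMarkovLatticeOperator S) {s s' t t' : Set X}
    {hs : MeasurableSet s} {hs' : MeasurableSet s'} {ht : MeasurableSet t}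
    {ht' : MeasurableSet t'} (h : S (ind μ p hs) = ind μ p ht)
    (h' : S (ind μ p hs') = ind μ p ht') (hss' : s ⊆ s') : ∀ᵐ x ∂μ, x ∈ t → x ∈ t' := by
  have hn : Nonneg (ind μ p hs' - ind μ p hs) := by
    filter_upwards [coeFn_ind (μ := μ) (p := p) hs, coeFn_ind (μ := μ) (p := p) hs',
      Lp.coeFn_sub (ind μ p hs') (ind μ p hs)] with x h1 h2 h3
    rw [h3, Pi.sub_apply, h1, h2]
    by_cases hx : x ∈ s
    · simp [hx, hss' hx]
    · by_cases hx' : x ∈ s' <;> simp [hx, hx']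
  have := hS.nonneg _ hn
  rw [map_sub, h, h'] at this
  filter_upwards [this, coeFn_ind (μ := μ) (p := p) ht, coeFn_ind (μ := μ) (p := p) ht',
    Lp.coeFn_sub (ind μ p ht') (ind μ p ht)] with x h1 h2 h3 h4 hx
  rw [h4, Pi.sub_apply, h2, h3] at h1
  by_contra hx'
  norm_num [hx, hx'] at h1

/-- Monotonicity gives `t ∪ t' ⊆ u` and `v ⊆ t ∩ t'`. The image of `𝟙_{s ∪ s'} + 𝟙_{s ∩ s'} = 𝟙_s +
𝟙_{s'}` forces equality in both. -/
theorem union_inter (hS : IsMarkovLatticeOperator S) {s s' t t' u v : Set X}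
    {hs : MeasurableSet s} {hs' : MeasurableSet s'} {ht : MeasurableSet t}
    {ht' : MeasurableSet t'} {hu : MeasurableSet u} {hv : MeasurableSet v}
    (h : S (ind μ p hs) = ind μ p ht)
    (h' : S (ind μ p hs') = ind μ p ht') (h_union : S (ind μ p (hs.union hs')) = ind μ p hu)
    (h_inter : S (ind μ p (hs.inter hs')) = ind μ p hv) :
    u =ᵐ[μ] (t ∪ t' : Set X) ∧ v =ᵐ[μ] (t ∩ t' : Set X) := by
  have hsum : ind μ p hu + ind μ p hv = ind μ p ht + ind μ p ht' := by
    rw [← h, ← h', ← h_union, ← h_inter, ← map_add, ← map_add]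
    congr 1
    refine Lp.ext ?_
    filter_upwards [coeFn_ind (μ := μ) (p := p) hs, coeFn_ind (μ := μ) (p := p) hs',
      coeFn_ind (μ := μ) (p := p) (hs.union hs'), coeFn_ind (μ := μ) (p := p) (hs.inter hs'),
      Lp.coeFn_add (ind μ p hs) (ind μ p hs'),
      Lp.coeFn_add (ind μ p (hs.union hs')) (ind μ p (hs.inter hs'))] with x h1 h2 h3 h4 h5 h6
    rw [h5, h6, Pi.add_apply, Pi.add_apply, h1, h2, h3, h4]
    by_cases hx : x ∈ s <;> by_cases hx' : x ∈ s' <;> simp [hx, hx']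
  have key : ∀ᵐ x ∂μ, (x ∈ u ↔ x ∈ t ∪ t') ∧ (x ∈ v ↔ x ∈ t ∩ t') := by
    filter_upwards [hS.ae_le_of_subset h h_union Set.subset_union_left,
      hS.ae_le_of_subset h' h_union Set.subset_union_right,
      hS.ae_le_of_subset h_inter h Set.inter_subset_left,
      hS.ae_le_of_subset h_inter h' Set.inter_subset_right,
      coeFn_ind (μ := μ) (p := p) ht, coeFn_ind (μ := μ) (p := p) ht',
      coeFn_ind (μ := μ) (p := p) hu, coeFn_ind (μ := μ) (p := p) hv,
      Lp.coeFn_add (ind μ p ht) (ind μ p ht'),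
      Lp.coeFn_add (ind μ p hu) (ind μ p hv)] with x i1 i2 i3 i4 h1 h2 h3 h4 h5 h6
    rw [hsum, h5, Pi.add_apply, Pi.add_apply, h1, h2, h3, h4] at h6
    by_cases x1 : x ∈ t <;> by_cases x2 : x ∈ t' <;> by_cases x3 : x ∈ u <;>
      by_cases x4 : x ∈ v <;> simp_all
  exact ⟨key.mono fun x hx => propext hx.1, key.mono fun x hx => propext hx.2⟩

theorem mapsIndicators (hS : IsMarkovLatticeOperator S) : MapsIndicators S := by
  intro s s' hs hs'
  obtain ⟨t, ht, h⟩ := hS.exists_ind hs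
  obtain ⟨t', ht', h'⟩ := hS.exists_ind hs'
  obtain ⟨u, hu, h_union⟩ := hS.exists_ind (hs.union hs')
  obtain ⟨v, hv, h_inter⟩ := hS.exists_ind (hs.inter hs')
  refine ⟨t, t', ht, ht', h, h', ?_⟩
  rw [h_inter, ind_eq_ind_iff]
  exact (hS.union_inter h h' h_union h_inter).2

theorem exists_indicator (hS : IsMarkovLatticeOperator S) (M : MeasureAlgebra μ) :
    ∃ N : MeasureAlgebra μ, S (M.indicator p) = N.indicator p := by
  obtain ⟨⟨s, hs⟩, rfl⟩ := Quotient.exists_rep M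
  obtain ⟨t, ht, h⟩ := hS.exists_ind hs
  exact ⟨MeasureAlgebra.mk μ t ht, h⟩

theorem map_sup_and_inf (hS : IsMarkovLatticeOperator S) {M M' N N' U V : MeasureAlgebra μ}
    (h : S (M.indicator p) = N.indicator p) (h' : S (M'.indicator p) = N'.indicator p)
    (h_sup : S ((M ⊔ M').indicator p) = U.indicator p)
    (h_inf : S ((M ⊓ M').indicator p) = V.indicator p) : U = N ⊔ N' ∧ V = N ⊓ N' := by
  obtain ⟨⟨s, hs⟩, rfl⟩ := Quotient.exists_rep M
  obtain ⟨⟨s', hs'⟩, rfl⟩ := Quotient.exists_rep M'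
  obtain ⟨⟨t, ht⟩, rfl⟩ := Quotient.exists_rep N
  obtain ⟨⟨t', ht'⟩, rfl⟩ := Quotient.exists_rep N'
  obtain ⟨⟨u, hu⟩, rfl⟩ := Quotient.exists_rep U
  obtain ⟨⟨v, hv⟩, rfl⟩ := Quotient.exists_rep V
  obtain ⟨h1, h2⟩ := hS.union_inter (hs := hs) (hs' := hs') (ht := ht) (ht' := ht') (hu := hu)
    (hv := hv) h h' h_sup h_inf
  exact ⟨Quotient.sound (s := measurableSetSetoid μ) h1,
    Quotient.sound (s := measurableSetSetoid μ) h2⟩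

theorem exists_measureAlgebraHom (hS : IsMarkovLatticeOperator S) :
    ∃ θ : MeasureAlgebraHom μ, ∀ M : MeasureAlgebra μ,
      S (M.indicator p) = (θ.toLatticeHom M).indicator p := by
  choose θ hθ using hS.exists_indicator
  refine ⟨⟨⟨⟨θ, fun M M' => ?_⟩, fun M M' => ?_⟩, fun M => ?_⟩, hθ⟩
  · exact (hS.map_sup_and_inf (hθ M) (hθ M') (hθ (M ⊔ M')) (hθ (M ⊓ M'))).1
  · exact (hS.map_sup_and_inf (hθ M) (hθ M') (hθ (M ⊔ M')) (hθ (M ⊓ M'))).2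
  · have h := hθ M
    change (θ M).measure = M.measure
    generalize θ M = N at h
    obtain ⟨⟨s, hs⟩, rfl⟩ := Quotient.exists_rep M
    obtain ⟨⟨t, ht⟩, rfl⟩ := Quotient.exists_rep N
    change S (ind μ p hs) = ind μ p ht at h
    change μ t = μ s
    have hi := hS.integral_map (ind μ p hs)
    rw [h, integral_ind, integral_ind, Complex.ofReal_inj] at hi
    exact (ENNReal.toReal_eq_toReal_iff' (measure_ne_top _ _) (measure_ne_top _ _)).1 hi

/-- Positivity is applied to `K·𝟙 - |f|`, using that `S` fixes `𝟙` and commutes with the modulus. -/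
theorem map_essBall (hS : IsMarkovLatticeOperator S) {f : Lp ℂ p μ} {K : ℝ}
    (hf : f ∈ essBall μ p K) : S f ∈ essBall μ p K := by
  have hn : Nonneg ((K : ℂ) • Lp.const p μ (1 : ℂ) - modulus f) := by
    filter_upwards [hf, coeFn_modulus f, Lp.coeFn_smul (K : ℂ) (Lp.const p μ (1 : ℂ)),
      Lp.coeFn_sub ((K : ℂ) • Lp.const p μ (1 : ℂ)) (modulus f),
      coeFn_const_one (μ := μ) (p := p)] with x h1 h2 h3 h4 h5
    rw [h4, Pi.sub_apply, h3, h2, Pi.smul_apply, h5]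
    simpa using h1
  have hn' := hS.nonneg _ hn
  rw [map_sub, map_smul, hS.map_one, ← hS.modulus_map] at hn'
  change ∀ᵐ x ∂μ, _
  filter_upwards [hn', coeFn_modulus (S f), Lp.coeFn_smul (K : ℂ) (Lp.const p μ (1 : ℂ)),
    Lp.coeFn_sub ((K : ℂ) • Lp.const p μ (1 : ℂ)) (modulus (S f)),
    coeFn_const_one (μ := μ) (p := p)] with x h1 h2 h3 h4 h5
  rw [h4, Pi.sub_apply, h3, h2, Pi.smul_apply, h5] at h1
  simpa using h1.1

theorem map_boundedPart (hS : IsMarkovLatticeOperator S) {f : Lp ℂ p μ}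
    (hf : f ∈ boundedPart μ p) : S f ∈ boundedPart μ p := by
  obtain ⟨K, -, hK⟩ := exists_mem_essBall hf
  exact mem_boundedPart_of_mem_essBall (hS.map_essBall hK)

end IsMarkovLatticeOperator

end Koopman

/-! ### From Markov lattice operators to a derivation. -/

namespace Koopman

variable {X : Type*} [MeasurableSpace X] {μ : Measure X} {p : ℝ≥0∞}

section

variable [Fact (1 ≤ p)]

theorem forwardQuot_star (u : ℝ≥0 → Lp ℂ p μ) (s h : ℝ≥0) :
    forwardQuot (fun r => star (u r)) s h = star (forwardQuot u s h) := by
  simp [forwardQuot, star_smul_Lp, star_sub_Lp]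

theorem C0Semigroup.forwardQuot_orbit_zero (T : C0Semigroup (Lp ℂ p μ)) (f : Lp ℂ p μ) :
    forwardQuot (fun s => T.op s f) 0 = T.quot f := by
  funext h
  simp [forwardQuot, C0Semigroup.quot, T.op_zero]

theorem C0Semigroup.tendsto_quot_star {T : C0Semigroup (Lp ℂ p μ)}
    (h : ∀ t f, T.op t (star f) = star (T.op t f))
    {f f' : Lp ℂ p μ} (hf' : Tendsto (T.quot f) (𝓝[>] 0) (𝓝 f')) :
    Tendsto (T.quot (star f)) (𝓝[>] 0) (𝓝 (star f')) := by
  rw [← T.forwardQuot_orbit_zero] at hf' ⊢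
  simp only [h]
  exact ((continuous_star_Lp.tendsto f').comp hf').congr fun r => (forwardQuot_star _ _ r).symm

/-- The increment of `u v` is `Δu · v(s + h) + u(s) · Δv`. Only `v` is evaluated at a moving time
beside a varying factor, so only `v` needs a uniform bound. -/
theorem tendsto_forwardQuot_mul [IsFiniteMeasure μ] (hp : p ≠ ∞) {u v : ℝ≥0 → Lp ℂ p μ}
    {u' v' : Lp ℂ p μ} {s : ℝ≥0}
    (hu : ∀ r, u r ∈ boundedPart μ p) (hv : ∀ r, v r ∈ boundedPart μ p)
    (hu' : Tendsto (forwardQuot u s) (𝓝[>] 0) (𝓝 u'))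
    (hv' : Tendsto (forwardQuot v s) (𝓝[>] 0) (𝓝 v')) (hvc : Continuous v) {K : ℝ}
    (hK : ∀ᶠ h in 𝓝[>] 0, v (s + h) ∈ essBall μ p K) :
    Tendsto (forwardQuot (fun r => mulBounded (u r) (v r) (hv r)) s) (𝓝[>] 0)
      (𝓝 (mulBounded u' (v s) (hv s) + mulBounded v' (u s) (hu s))) := by
  have hvs : Tendsto (fun h => v (s + h)) (𝓝[>] 0) (𝓝 (v s)) := by
    have : Continuous fun h => v (s + h) := by fun_prop
    simpa using (this.tendsto 0).mono_left nhdsWithin_le_nhds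
  have h1 := tendsto_mulBounded hp (fun h => hv (s + h)) (hv s) hu' hvs hK
  have h2 := ((mulBoundedCLM (u s) (hu s)).continuous.tendsto v').comp hv'
  refine (h1.add h2).congr fun h => ?_
  have e : mulBounded (u s) (v (s + h)) (hv (s + h)) - mulBounded (u s) (v s) (hv s) =
      mulBounded (v (s + h) - v s) (u s) (hu s) := by
    rw [mulBounded_comm (hu s) (hv _), mulBounded_comm (hu s) (hv s)]
    simp only [← mulBoundedCLM_apply, map_sub]
  simp only [forwardQuot, Function.comp, ← mulBoundedCLM_apply, map_smul, ← smul_add]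
  congr 1
  simp only [mulBoundedCLM_apply, ← e]
  rw [← mulBoundedCLM_apply, map_sub]
  simp only [mulBoundedCLM_apply]
  abel

end

namespace C0Semigroup

variable [IsProbabilityMeasure μ] [Fact (1 ≤ p)] (T : C0Semigroup (Lp ℂ p μ))

theorem dense_bounded_domain (hp : p ≠ ∞)
    (h : ∀ t K, ∀ f ∈ essBall μ p K, T.op t f ∈ essBall μ p K) :
    Dense ((boundedPart μ p ⊓ T.generator.domain : Submodule ℂ (Lp ℂ p μ)) :
      Set (Lp ℂ p μ)) := by
  rw [← dense_closure]
  refine (dense_boundedPart hp).mono fun f hf => ?_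
  obtain ⟨K, -, hK⟩ := exists_mem_essBall hf
  refine mem_closure_of_tendsto (T.tendsto_orbitMean f) ?_
  filter_upwards [self_mem_nhdsWithin] with r hr
  refine ⟨mem_boundedPart_of_mem_essBall (K := K) ?_, T.orbitMean_mem_domain f r⟩
  exact T.orbitMean_mem f (by simpa using hr) (convex_essBall K) (isClosed_essBall K)
    fun t => h t K f hK

variable {T}

theorem tendsto_quot_mul_of_isMarkov (hp : p ≠ ∞) (h : ∀ t, IsMarkovLatticeOperator (T.op t))
    {f g f' g' : Lp ℂ p μ} (hf : f ∈ boundedPart μ p) (hg : g ∈ boundedPart μ p)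
    (hf' : Tendsto (T.quot f) (𝓝[>] 0) (𝓝 f')) (hg' : Tendsto (T.quot g) (𝓝[>] 0) (𝓝 g')) :
    Tendsto (T.quot (mulBounded f g hg)) (𝓝[>] 0)
      (𝓝 (mulBounded f' g hg + mulBounded g' f hf)) := by
  obtain ⟨K, -, hK⟩ := exists_mem_essBall hg
  rw [← T.forwardQuot_orbit_zero] at hf' hg' ⊢
  have := tendsto_forwardQuot_mul hp (fun r => (h r).map_boundedPart hf)
    (fun r => (h r).map_boundedPart hg) hf' hg' (T.continuous_orbit g) (K := K)
    (Eventually.of_forall fun r => (h _).map_essBall hK)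
  simp only [T.op_zero, ContinuousLinearMap.id_apply] at this
  convert this using 3 with r
  exact (h r).mapsIndicators.map_mul hp hf ((h r).map_boundedPart hf) hg _

theorem hasDerivationGenerator_of_isMarkov (hp : p ≠ ∞)
    (h : ∀ t, IsMarkovLatticeOperator (T.op t)) : HasDerivationGenerator T where
  invariant t f hf := (h t).map_boundedPart hf
  dense := T.dense_bounded_domain hp fun t K f hf => (h t).map_essBall hf
  derivation :=
    { bounded := fun f hf => hf.1
      one_mem := by
        refine ⟨?_, 0, ?_⟩
        · rw [const_one_eq_ind]; exact ind_mem _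
        · have : T.quot (Lp.const p μ (1 : ℂ)) = fun _ => 0 := by
            funext r; simp [quot, (h r).map_one]
          rw [this]
          exact tendsto_const_nhds
      mul_mem := fun f g hf hg => ⟨mulBounded_mem hf.1 hg.1, _,
        tendsto_quot_mul_of_isMarkov hp h hf.1 hg.1 (T.tendsto_generator ⟨f, hf.2⟩)
          (T.tendsto_generator ⟨g, hg.2⟩)⟩
      star_mem := fun f hf => ⟨star_mem_boundedPart hf.1, _,
        tendsto_quot_star (fun t => (h t).mapsIndicators.map_star hp)
          (T.tendsto_generator ⟨f, hf.2⟩)⟩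
      map_mul := fun f g hf hg => T.generator_eq _ (tendsto_quot_mul_of_isMarkov hp h hf.1 hg.1
        (T.tendsto_generator ⟨f, hf.2⟩) (T.tendsto_generator ⟨g, hg.2⟩))
      map_star := fun f hf => T.generator_eq _
        (tendsto_quot_star (fun t => (h t).mapsIndicators.map_star hp)
          (T.tendsto_generator ⟨f, hf.2⟩)) }
  integral_generator f := by
    have h1 := ((integralCLM (μ := μ) (p := p)).continuous.tendsto _).comp (T.tendsto_generator f)
    refine tendsto_nhds_unique h1 ?_
    have : (integralCLM ∘ T.quot f : ℝ≥0 → ℂ) = fun _ => 0 := by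
      funext r
      simp only [Function.comp, quot, map_smul, map_sub]
      rw [integralCLM_apply, integralCLM_apply, (h r).integral_map, sub_self, smul_zero]
    rw [this]
    exact tendsto_const_nhds

end C0Semigroup

end Koopman

namespace Koopman

variable {X : Type*} [MeasurableSpace X] {μ : Measure X} {p : ℝ≥0∞}

/-! ### The restriction of an operator to `L^∞` -/

section Restrict

variable [IsProbabilityMeasure μ] [Fact (1 ≤ p)]

theorem memLp_of_Lp_top (p : ℝ≥0∞) (f : Lp ℂ ∞ μ) : MemLp f p μ :=
  (Lp.memLp f).mono_exponent le_top

/-- The inclusion of `L^∞` into `L^p`. -/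
noncomputable def inclusionCLM (μ : Measure X) [IsProbabilityMeasure μ] (p : ℝ≥0∞)
    [Fact (1 ≤ p)] : Lp ℂ ∞ μ →L[ℂ] Lp ℂ p μ :=
  LinearMap.mkContinuous
    { toFun := fun f => (memLp_of_Lp_top p f).toLp f
      map_add' := by
        intro f g
        rw [← MemLp.toLp_add]
        exact MemLp.toLp_congr _ _ (Lp.coeFn_add f g)
      map_smul' := by
        intro c f
        rw [RingHom.id_apply, ← MemLp.toLp_const_smul]
        exact MemLp.toLp_congr _ _ (Lp.coeFn_smul c f) }
    1 (by
      intro f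
      rw [one_mul, Lp.norm_def f]
      refine (Lp.norm_toLp f (memLp_of_Lp_top p f)).trans_le (ENNReal.toReal_mono (Lp.eLpNorm_ne_top f) ?_)
      exact eLpNorm_le_eLpNorm_of_exponent_le le_top (Lp.aestronglyMeasurable f))

theorem coeFn_inclusionCLM (f : Lp ℂ ∞ μ) : inclusionCLM μ p f =ᵐ[μ] f :=
  (memLp_of_Lp_top p f).coeFn_toLp

theorem inclusionCLM_injective : Function.Injective (inclusionCLM μ p) := by
  intro f g h
  refine Lp.ext ?_
  filter_upwards [coeFn_inclusionCLM (p := p) f, coeFn_inclusionCLM (p := p) g] with x h1 h2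
  rw [← h1, ← h2, h]

theorem inclusionCLM_mem (f : Lp ℂ ∞ μ) : inclusionCLM μ p f ∈ boundedPart μ p :=
  (Lp.memLp f).ae_eq (coeFn_inclusionCLM f).symm

theorem exists_inclusionCLM_eq {f : Lp ℂ p μ} (hf : f ∈ boundedPart μ p) :
    ∃ g : Lp ℂ ∞ μ, inclusionCLM μ p g = f := by
  have hf' : MemLp f ∞ μ := hf
  refine ⟨hf'.toLp f, Lp.ext ?_⟩
  filter_upwards [coeFn_inclusionCLM (p := p) (hf'.toLp f), hf'.coeFn_toLp] with x h1 h2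
  rw [h1, h2]

theorem norm_le_of_inclusionCLM_mem {f : Lp ℂ ∞ μ} {K : ℝ} (hK0 : 0 ≤ K)
    (hK : inclusionCLM μ p f ∈ essBall μ p K) : ‖f‖ ≤ K := by
  have := Lp.norm_le_of_ae_bound (f := f) hK0 (by
    filter_upwards [hK, coeFn_inclusionCLM (p := p) f] with x h1 h2
    rwa [h2] at h1)
  simpa using this

theorem inclusionCLM_mem_essBall (f : Lp ℂ ∞ μ) : inclusionCLM μ p f ∈ essBall μ p ‖f‖ := by
  change ∀ᵐ x ∂μ, _
  filter_upwards [coeFn_inclusionCLM (p := p) f, ae_le_eLpNormEssSup (f := f) (μ := μ)]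
    with x h1 h2
  rw [h1, Lp.norm_def, ← toReal_enorm, eLpNorm_exponent_top]
  refine ENNReal.toReal_mono ?_ h2
  rw [← eLpNorm_exponent_top]
  exact Lp.eLpNorm_ne_top f

/-- An operator on `L^p` which leaves `L^∞` invariant is bounded on `L^∞`. -/
theorem exists_map_essBall {S : Lp ℂ p μ →L[ℂ] Lp ℂ p μ}
    (hS : ∀ f ∈ boundedPart μ p, S f ∈ boundedPart μ p) (K : ℝ) :
    ∃ L, ∀ f ∈ essBall μ p K, S f ∈ essBall μ p L := by
  choose R hR using fun f : Lp ℂ ∞ μ => exists_inclusionCLM_eq (hS _ (inclusionCLM_mem f))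
  let R' : Lp ℂ ∞ μ →ₗ[ℂ] Lp ℂ ∞ μ :=
    { toFun := R
      map_add' := fun f g => inclusionCLM_injective (p := p) (by simp only [hR, map_add])
      map_smul' := fun c f => inclusionCLM_injective (p := p) (by
        simp only [hR, map_smul, RingHom.id_apply]) }
  have hcont : Continuous R' := by
    -- Closed graph theorem: both candidate limits are compared in `L^p`, where `S` is continuous,
    -- and the inclusion of `L^∞` is injective.
    refine R'.continuous_of_seq_closed_graph fun u x y hu hy => ?_
    refine inclusionCLM_injective (p := p) ?_
    change _ = inclusionCLM μ p (R x)
    rw [hR]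
    refine tendsto_nhds_unique (((inclusionCLM μ p).continuous.tendsto y).comp hy) ?_
    refine ((((S.comp (inclusionCLM μ p)).continuous.tendsto x).comp hu)).congr fun n => ?_
    exact (hR (u n)).symm
  let R'' : Lp ℂ ∞ μ →L[ℂ] Lp ℂ ∞ μ := ⟨R', hcont⟩
  refine ⟨‖R''‖ * max K 0, fun f hf => ?_⟩
  obtain ⟨g, rfl⟩ := exists_inclusionCLM_eq (mem_boundedPart_of_mem_essBall hf)
  have hg : ‖g‖ ≤ max K 0 :=
    norm_le_of_inclusionCLM_mem (le_max_right _ _) (essBall_mono (le_max_left _ _) hf)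
  rw [← hR]
  refine essBall_mono ?_ (inclusionCLM_mem_essBall (R g))
  exact (R''.le_opNorm g).trans (by gcongr)

end Restrict

/-! ### Bounded solutions -/

/-- A solution of `u' = A u` in `L^p` which is locally bounded in `L^∞`. -/
structure IsBoundedSolution [Fact (1 ≤ p)] (T : C0Semigroup (Lp ℂ p μ)) (u : ℝ≥0 → Lp ℂ p μ) :
    Prop extends IsSolution T u where
  locally_bounded : ∀ s, ∃ K, ∀ᶠ r in 𝓝 s, u r ∈ essBall μ p K

namespace IsBoundedSolution

variable [Fact (1 ≤ p)] {T : C0Semigroup (Lp ℂ p μ)} {u v : ℝ≥0 → Lp ℂ p μ}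

theorem mem_boundedPart (hu : IsBoundedSolution T u) (s : ℝ≥0) : u s ∈ boundedPart μ p := by
  obtain ⟨K, hK⟩ := hu.locally_bounded s
  exact mem_boundedPart_of_mem_essBall hK.self_of_nhds

theorem mem_domain (hu : IsBoundedSolution T u) (s : ℝ≥0) :
    u s ∈ boundedPart μ p ⊓ T.generator.domain := by
  obtain ⟨g, hg, -⟩ := hu.tendsto_quot s
  exact ⟨hu.mem_boundedPart s, g, hg⟩

theorem tendsto_forwardQuot (hu : IsBoundedSolution T u) (s : ℝ≥0) :
    Tendsto (forwardQuot u s) (𝓝[>] 0) (𝓝 (T.generator ⟨u s, (hu.mem_domain s).2⟩)) := by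
  obtain ⟨g, hg, hg'⟩ := hu.tendsto_quot s
  rwa [T.generator_eq _ hg]

theorem add (hu : IsBoundedSolution T u) (hv : IsBoundedSolution T v) :
    IsBoundedSolution T fun s => u s + v s where
  continuous := hu.continuous.add hv.continuous
  tendsto_quot s := by
    obtain ⟨g, h1, h2⟩ := hu.tendsto_quot s
    obtain ⟨g', h1', h2'⟩ := hv.tendsto_quot s
    refine ⟨g + g', ?_, (h2.add h2').congr fun h => ?_⟩
    · rw [T.quot_add]
      exact h1.add h1'
    · simp only [forwardQuot, ← smul_add]
      congr 1
      abel
  locally_bounded s := by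
    obtain ⟨K, hK⟩ := hu.locally_bounded s
    obtain ⟨L, hL⟩ := hv.locally_bounded s
    refine ⟨K + L, ?_⟩
    filter_upwards [hK, hL] with r h1 h2
    change ∀ᵐ x ∂μ, _
    filter_upwards [h1, h2, Lp.coeFn_add (u r) (v r)] with x i1 i2 i3
    rw [i3]
    exact (norm_add_le _ _).trans (add_le_add i1 i2)

variable [IsProbabilityMeasure μ]

theorem star (H : HasDerivationGenerator T) (hu : IsBoundedSolution T u) :
    IsBoundedSolution T fun s => star (u s) where
  continuous := continuous_star_Lp.comp hu.continuous
  tendsto_quot s := by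
    have h1 := T.tendsto_generator ⟨_, (H.derivation.star_mem _ (hu.mem_domain s)).2⟩
    refine ⟨_, h1, ?_⟩
    have h2 := H.derivation.map_star _ (hu.mem_domain s)
    change T.generator ⟨_, (H.derivation.star_mem _ (hu.mem_domain s)).2⟩ = Star.star
      (T.generator ⟨u s, (hu.mem_domain s).2⟩) at h2
    rw [h2]
    exact ((continuous_star_Lp.tendsto _).comp (hu.tendsto_forwardQuot s)).congr
      fun r => (forwardQuot_star _ _ r).symm
  locally_bounded s := by
    obtain ⟨K, hK⟩ := hu.locally_bounded s
    exact ⟨K, hK.mono fun r hr => star_mem_essBall hr⟩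

theorem mul (hp : p ≠ ∞) (H : HasDerivationGenerator T) (hu : IsBoundedSolution T u)
    (hv : IsBoundedSolution T v) :
    IsBoundedSolution T fun s => mulBounded (u s) (v s) (hv.mem_boundedPart s) where
  continuous := by
    rw [continuous_iff_continuousAt]
    intro s
    obtain ⟨K, hK⟩ := hv.locally_bounded s
    exact tendsto_mulBounded hp hv.mem_boundedPart (hv.mem_boundedPart s)
      (hu.continuous.tendsto s) (hv.continuous.tendsto s) hK
  tendsto_quot s := by
    have hm := H.derivation.mul_mem _ _ (hu.mem_domain s) (hv.mem_domain s)
    refine ⟨_, T.tendsto_generator ⟨_, hm.2⟩, ?_⟩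
    have h2 : T.generator ⟨_, hm.2⟩ = mulBounded (T.generator ⟨u s, (hu.mem_domain s).2⟩) (v s)
        (hv.mem_boundedPart s) + mulBounded (T.generator ⟨v s, (hv.mem_domain s).2⟩) (u s)
        (hu.mem_boundedPart s) :=
      H.derivation.map_mul _ _ (hu.mem_domain s) (hv.mem_domain s)
    rw [h2]
    obtain ⟨K, hK⟩ := hv.locally_bounded s
    refine tendsto_forwardQuot_mul hp hu.mem_boundedPart hv.mem_boundedPart
      (hu.tendsto_forwardQuot s) (hv.tendsto_forwardQuot s) hv.continuous (K := K) ?_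
    have : Continuous fun h => s + h := by fun_prop
    have h3 : Tendsto (fun h => s + h) (𝓝[>] 0) (𝓝 s) := by
      simpa using (this.tendsto 0).mono_left nhdsWithin_le_nhds
    exact h3.eventually hK
  locally_bounded s := by
    obtain ⟨K, hK⟩ := hu.locally_bounded s
    obtain ⟨L, hL⟩ := hv.locally_bounded s
    refine ⟨K * L, ?_⟩
    filter_upwards [hK, hL] with r h1 h2
    exact mulBounded_mem_essBall h1 h2

end IsBoundedSolution

/-! ### From a derivation to Markov lattice operators. -/

namespace HasDerivationGenerator

variable [IsProbabilityMeasure μ] [Fact (1 ≤ p)] {T : C0Semigroup (Lp ℂ p μ)}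

/-- The Leibniz rule for `𝟙 = 𝟙 · 𝟙` reads `A𝟙 = A𝟙 + A𝟙`. -/
theorem tendsto_quot_one (H : HasDerivationGenerator T) :
    Tendsto (T.quot (Lp.const p μ (1 : ℂ))) (𝓝[>] 0) (𝓝 0) := by
  have h1 := H.derivation.one_mem
  have hm := H.derivation.map_mul _ _ h1 h1
  have e : mulBounded (Lp.const p μ (1 : ℂ)) (Lp.const p μ (1 : ℂ)) h1.1 =
      Lp.const p μ (1 : ℂ) := by
    rw [mulBounded_eq_iff]
    filter_upwards [coeFn_const_one (μ := μ) (p := p)] with x hx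
    rw [hx, mul_one]
  have e' (f : Lp ℂ p μ) : mulBounded f (Lp.const p μ (1 : ℂ)) h1.1 = f := by
    rw [mulBounded_eq_iff]
    filter_upwards [coeFn_const_one (μ := μ) (p := p)] with x hx
    rw [hx, mul_one]
  simp only [e, e'] at hm
  have h0 : T.generator ⟨_, h1.2⟩ = 0 := left_eq_add.1 hm
  rw [← h0]
  exact T.tendsto_generator ⟨_, h1.2⟩

theorem isBoundedSolution_const (H : HasDerivationGenerator T) (c : ℂ) :
    IsBoundedSolution T fun _ => c • Lp.const p μ (1 : ℂ) where
  continuous := continuous_const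
  tendsto_quot s := by
    refine ⟨0, ?_, ?_⟩
    · rw [T.quot_smul]
      simpa using H.tendsto_quot_one.const_smul c
    · have : forwardQuot (fun _ => c • Lp.const p μ (1 : ℂ)) s = fun _ => 0 := by
        funext h; simp [forwardQuot]
      rw [this]
      exact tendsto_const_nhds
  locally_bounded s := by
    obtain ⟨K, -, hK⟩ := exists_mem_essBall
      ((boundedPart μ p).smul_mem c H.derivation.one_mem.1)
    exact ⟨K, Eventually.of_forall fun _ => hK⟩

theorem op_one (H : HasDerivationGenerator T) (t : ℝ≥0) :
    T.op t (Lp.const p μ (1 : ℂ)) = Lp.const p μ (1 : ℂ) := by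
  have := (H.isBoundedSolution_const 1).toIsSolution.eq_op t
  rw [one_smul] at this
  exact this.symm

theorem exists_polynomial_solution (hp : p ≠ ∞) (H : HasDerivationGenerator T)
    {u : ℝ≥0 → Lp ℂ p μ} (hu : IsBoundedSolution T u) (P : Polynomial ℝ) :
    ∃ w : ℝ≥0 → Lp ℂ p μ, IsBoundedSolution T w ∧
      ∀ r, ∀ᵐ x ∂μ, w r x = ((P.eval (‖u r x‖ ^ 2) : ℝ) : ℂ) := by
  induction P using Polynomial.induction_on with
  | C a =>
    refine ⟨_, H.isBoundedSolution_const a, fun r => ?_⟩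
    filter_upwards [Lp.coeFn_smul (a : ℂ) (Lp.const p μ (1 : ℂ)),
      coeFn_const_one (μ := μ) (p := p)] with x h1 h2
    rw [h1, Pi.smul_apply, h2]
    simp
  | add P Q hP hQ =>
    obtain ⟨w, hw, h1⟩ := hP
    obtain ⟨w', hw', h1'⟩ := hQ
    refine ⟨_, hw.add hw', fun r => ?_⟩
    filter_upwards [h1 r, h1' r, Lp.coeFn_add (w r) (w' r)] with x i1 i2 i3
    rw [i3, Pi.add_apply, i1, i2, Polynomial.eval_add, Complex.ofReal_add]
  | monomial n a hP =>
    obtain ⟨w, hw, h1⟩ := hP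
    -- The degree is raised by multiplying with `u · conj u = |u|²`.
    refine ⟨_, hw.mul hp H (hu.mul hp H (hu.star H)), fun r => ?_⟩
    filter_upwards [h1 r, coeFn_mulBounded (w r) _ ((hu.mul hp H (hu.star H)).mem_boundedPart r),
      coeFn_mulBounded (u r) _ ((hu.star H).mem_boundedPart r), Lp.coeFn_star (u r)]
      with x i1 i2 i3 i4
    rw [i2, i3, i4, i1, Pi.star_apply, RCLike.star_def, Complex.mul_conj,
      Complex.normSq_eq_norm_sq, ← Complex.ofReal_mul]
    simp only [Polynomial.eval_mul, Polynomial.eval_C, Polynomial.eval_pow, Polynomial.eval_X]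
    congr 1
    ring

theorem op_modulus_solution (hp : p ≠ ∞) (H : HasDerivationGenerator T)
    {u : ℝ≥0 → Lp ℂ p μ} (hu : IsBoundedSolution T u) (t : ℝ≥0) :
    T.op t (modulus (u 0)) = modulus (u t) := by
  obtain ⟨K, hK0, hK⟩ := exists_mem_essBall (hu.mem_boundedPart 0)
  obtain ⟨L, hL0, hL⟩ := exists_mem_essBall (hu.mem_boundedPart t)
  set M := max K L
  have hM0 : 0 ≤ M := hK0.trans (le_max_left _ _)
  -- The interval `[0, M²]` contains the values of both `|u(0)|²` and `|u(t)|²`; no other times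
  -- matter.
  choose P hP using fun n : ℕ => exists_polynomial_near_of_continuousOn 0 (M ^ 2) Real.sqrt
    Real.continuous_sqrt.continuousOn (1 / ((n : ℝ) + 1)) (by positivity)
  choose w hw hwP using fun n => H.exists_polynomial_solution hp hu (P n)
  have key : ∀ r, u r ∈ essBall μ p M → Tendsto (fun n => w n r) atTop (𝓝 (modulus (u r))) := by
    intro r hr
    rw [tendsto_iff_norm_sub_tendsto_zero]
    refine squeeze_zero (fun _ => norm_nonneg _) (fun n => ?_) tendsto_one_div_add_atTop_nhds_zero_nat
    have := Lp.norm_le_of_ae_bound (f := w n r - modulus (u r)) (C := 1 / ((n : ℝ) + 1))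
      (by positivity) (by
        filter_upwards [hwP n r, coeFn_modulus (u r), Lp.coeFn_sub (w n r) (modulus (u r)), hr]
          with x h1 h2 h3 h4
        rw [h3, Pi.sub_apply, h1, h2, ← Complex.ofReal_sub, Complex.norm_real, Real.norm_eq_abs]
        have := hP n (‖u r x‖ ^ 2) ⟨by positivity, by gcongr⟩
        rw [Real.sqrt_sq (norm_nonneg _)] at this
        exact this.le)
    simpa [measureUnivNNReal] using this
  have h0 := ((T.op t).continuous.tendsto _).comp (key 0 (essBall_mono (le_max_left _ _) hK))
  refine tendsto_nhds_unique h0 ((key t (essBall_mono (le_max_right _ _) hL)).congr fun n => ?_)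
  exact (hw n).toIsSolution.eq_op t

/-- Orbits of bounded functions are locally bounded in `L^∞` away from zero. -/
theorem exists_locally_bounded_orbit (H : HasDerivationGenerator T) {f : Lp ℂ p μ}
    (hf : f ∈ boundedPart μ p) {ε : ℝ≥0} (hε : 0 < ε) :
    ∃ a < ε, ∀ s, ∃ K, ∀ᶠ r in 𝓝 s, T.op r (T.op a f) ∈ essBall μ p K := by
  -- Baire: the closed sets of times at which the orbit is bounded by `n` cover the half-line, so
  -- their interiors have dense union.
  have hdense := dense_iUnion_interior_of_closed (f := fun n : ℕ => {r | T.op r f ∈ essBall μ p n})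
    (fun n => (isClosed_essBall _).preimage (T.continuous_orbit f)) (by
      refine Set.eq_univ_of_forall fun r => Set.mem_iUnion.2 ?_
      obtain ⟨K, -, hK⟩ := exists_mem_essBall (H.invariant r f hf)
      obtain ⟨n, hn⟩ := exists_nat_ge K
      exact ⟨n, essBall_mono hn hK⟩)
  obtain ⟨a, ⟨ha0, ha⟩, ha'⟩ := hdense.inter_open_nonempty (Set.Ioo 0 ε) isOpen_Ioo
    (Set.nonempty_Ioo.2 hε)
  obtain ⟨n, hn⟩ := Set.mem_iUnion.1 ha'
  refine ⟨a, ha, fun s => ?_⟩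
  obtain ⟨L, hL⟩ := exists_map_essBall (H.invariant s) n
  refine ⟨L, ?_⟩
  -- The bound near `a` is carried to times near `s` by `T(r) T(a) f = T(s) T(r + a - s) f`. Since
  -- `a > 0`, the subtraction is not truncated for `r` near `s`.
  have h1 : Tendsto (fun r => r + a - s) (𝓝 s) (𝓝 a) := by
    have : Continuous fun r : ℝ≥0 => r + a - s := by fun_prop
    simpa using this.tendsto s
  have h2 : ∀ᶠ r in 𝓝 s, s < r + a := by
    have : Continuous fun r : ℝ≥0 => r + a := by fun_prop
    exact (this.tendsto s).eventually (lt_mem_nhds (lt_add_of_pos_right s ha0))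
  filter_upwards [h1.eventually (mem_interior_iff_mem_nhds.1 hn), h2] with r hr hr'
  have := hL _ hr
  rwa [T.op_op, add_tsub_cancel_of_le hr'.le, ← T.op_op] at this

theorem op_modulus_of_mem (hp : p ≠ ∞) (H : HasDerivationGenerator T) {f : Lp ℂ p μ}
    (hf : f ∈ boundedPart μ p ⊓ T.generator.domain) (t : ℝ≥0) :
    modulus (T.op t f) = T.op t (modulus f) := by
  set Z : Set ℝ≥0 := {a | modulus (T.op t (T.op a f)) = T.op t (modulus (T.op a f))} with hZ
  have hclosed : IsClosed Z := isClosed_eq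
    (continuous_modulus.comp ((T.op t).continuous.comp (T.continuous_orbit f)))
    ((T.op t).continuous.comp (continuous_modulus.comp (T.continuous_orbit f)))
  -- The orbit of `f` itself need not be known to be bounded near time zero, so the identity is
  -- proved for arbitrarily small `a` and passed to the limit.
  have h0 : (0 : ℝ≥0) ∈ closure Z := by
    rw [Metric.mem_closure_iff]
    intro ε hε
    obtain ⟨a, ha, hb⟩ := H.exists_locally_bounded_orbit hf.1 (ε := ε.toNNReal) (by simpa using hε)
    refine ⟨a, ?_, ?_⟩
    · obtain ⟨g, hg⟩ := hf.2
      have hu : IsBoundedSolution T fun s => T.op s (T.op a f) :=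
        { toIsSolution := T.isSolution_orbit ⟨_, T.tendsto_quot_op a hg⟩
          locally_bounded := hb }
      have := H.op_modulus_solution hp hu t
      rw [T.op_zero] at this
      exact this.symm
    · rw [dist_comm, NNReal.dist_eq]
      simpa using (Real.lt_toNNReal_iff_coe_lt.1 ha)
  rw [hclosed.closure_eq] at h0
  simpa [hZ, T.op_zero] using h0

theorem modulus_op (hp : p ≠ ∞) (H : HasDerivationGenerator T) (t : ℝ≥0) (f : Lp ℂ p μ) :
    modulus (T.op t f) = T.op t (modulus f) :=
  congrFun (Continuous.ext_on H.dense (continuous_modulus.comp (T.op t).continuous)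
    ((T.op t).continuous.comp continuous_modulus) fun _ hf => H.op_modulus_of_mem hp hf t) f

end HasDerivationGenerator

/-- The constant semigroup of identity operators. -/
def C0Semigroup.trivial (E : Type*) [NormedAddCommGroup E] [NormedSpace ℂ E] : C0Semigroup E where
  op _ := ContinuousLinearMap.id ℂ E
  op_zero := rfl
  op_add _ _ := rfl
  continuous_orbit _ := continuous_const

namespace HasDerivationGenerator

variable [IsProbabilityMeasure μ] [Fact (1 ≤ p)] {T : C0Semigroup (Lp ℂ p μ)}

theorem integral_op (H : HasDerivationGenerator T) (t : ℝ≥0) (f : Lp ℂ p μ) :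
    ∫ x, T.op t f x ∂μ = ∫ x, f x ∂μ := by
  have key : Set.EqOn (fun f => integralCLM (T.op t f)) integralCLM
      ((boundedPart μ p ⊓ T.generator.domain : Submodule ℂ (Lp ℂ p μ)) : Set (Lp ℂ p μ)) := by
    intro f hf
    -- The integral along the orbit solves `u' = 0` in `ℂ`, so uniqueness for the constant semigroup
    -- makes it constant.
    have hs : IsSolution (C0Semigroup.trivial ℂ) fun s => integralCLM (T.op s f) :=
      { continuous := integralCLM.continuous.comp (T.continuous_orbit f)
        tendsto_quot := fun s => by
          refine ⟨0, ?_, ?_⟩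
          · have : (C0Semigroup.trivial ℂ).quot (integralCLM (T.op s f)) = fun _ => 0 := by
              funext h; simp [C0Semigroup.quot, C0Semigroup.trivial]
            rw [this]
            exact tendsto_const_nhds
          · obtain ⟨g, hg, hg'⟩ := (T.isSolution_orbit hf.2).tendsto_quot s
            have h0 : integralCLM g = 0 := by
              rw [← T.generator_eq ⟨g, hg⟩ hg]
              exact H.integral_generator _
            rw [← h0]
            refine ((integralCLM.continuous.tendsto g).comp hg').congr fun h => ?_
            simp [forwardQuot] }
    have := hs.eq_op t
    simpa [T.op_zero, C0Semigroup.trivial] using this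
  exact congrFun (Continuous.ext_on H.dense (integralCLM.continuous.comp (T.op t).continuous)
    integralCLM.continuous key) f

theorem isMarkovLatticeOperator (hp : p ≠ ∞) (H : HasDerivationGenerator T) (t : ℝ≥0) :
    IsMarkovLatticeOperator (T.op t) where
  nonneg _ := nonneg_map_of_modulus_map (H.modulus_op hp t)
  modulus_map := H.modulus_op hp t
  map_one := H.op_one t
  integral_map := H.integral_op t

end HasDerivationGenerator

end Koopman

theorem corollary2p3 {X : Type*} [MeasurableSpace X] (μ : Measure X) [IsProbabilityMeasure μ]
    (p : ℝ≥0∞) [Fact (1 ≤ p)] (hp : p ≠ ∞) (T : Koopman.C0Semigroup (Lp ℂ p μ)) :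
    List.TFAE [
      ∀ t : ℝ≥0, Koopman.IsMarkovLatticeOperator (T.op t),
      ∀ t : ℝ≥0, ∃ θ : Koopman.MeasureAlgebraHom μ, ∀ M : Koopman.MeasureAlgebra μ,
        T.op t (M.indicator p) = (θ.toLatticeHom M).indicator p,
      Koopman.HasDerivationGenerator T] := by
  tfae_have 1 → 2 := fun h t => (h t).exists_measureAlgebraHom
  tfae_have 2 → 1 := fun h t =>
    let ⟨θ, hθ⟩ := h t
    Koopman.isMarkovLatticeOperator_of_measureAlgebraHom hp θ hθ
  tfae_have 1 → 3 := Koopman.C0Semigroup.hasDerivationGenerator_of_isMarkov hp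
  tfae_have 3 → 1 := fun h t => h.isMarkovLatticeOperator hp t
  tfae_finish
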